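/- Let $\mathbb D$ be the open unit disc. For $0<p,q\le+\infty$ and a continuous function $g:\mathbb D\to\mathbb C$ define $\rho_{p,q}(g)\in[0,+\infty]$ by $$\rho_{p,q}(g)=\left(\frac1{2\pi}\int_0^{2\pi}\left(\int_0^1|g(re^{it})|^p\,dr\right)^{q/p}dt\right)^{1/q}\quad(p,q<+\infty),$$ $$\rho_{p,\infty}(g)=\operatorname*{ess\,sup}_{t\in[0,2\pi)}\left(\int_0^1|g(re^{it})|^p\,dr\right)^{1/p}\quad(p<+\infty),$$ $$\rho_{\infty,q}(g)=\left(\frac1{2\pi}\int_0^{2\pi}\left(\sup_{r\in[0,1)}|g(re^{it})|\right)^{q}dt\right)^{1/q}\quad(q<+\infty),\qquad \rho_{\infty,\infty}(g)=\sup_{z\in\mathbb D}|g(z)|,$$ and let $RM(p,q)$ be the space of all holomorphic functions $f:\mathbb D\to\mathbb C$ with $\rho_{p,q}(f)<+\infty$. Proposition (converse Littlewood–Paley inequality). Assume that $(p,q)$ satisfies one of the following: (a) $1<p,q<+\infty$; (b) $p=1$ and $1\le q<+\infty$; (c) $p=+\infty$ and $1\le q\le+\infty$. Then there is a constant $C=C(p,q)>0$,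 depending only on $p$ and $q$, such that $$\rho_{p,q}\big(f'(z)(1-|z|)\big)\le C\,\rho_{p,q}(f)\qquad\text{for all } f\in RM(p,q),$$ where the left-hand side is $\rho_{p,q}$ of the function $z\mapsto f'(z)(1-|z|)$ on $\mathbb D$. -/

import Mathlib

open MeasureTheory Set
open scoped ENNReal NNReal

noncomputable section

namespace AvgRadial

/-- The point `r e^{it}` of the complex plane. -/
def polar (r t : ℝ) : ℂ := (r : ℂ) * Complex.exp ((t : ℂ) * Complex.I)

/-- The average radial integrability functional `ρ_{p,q}` (for `0 < p, q ≤ ∞`), with values in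
`[0, ∞]`. Only the values of `g` on the open unit disc enter. It is applied here to functions that
are continuous on the disc, where the suprema in the last two cases agree with the corresponding
essential suprema. -/
def rho (p q : ℝ≥0∞) (g : ℂ → ℂ) : ℝ≥0∞ :=
  if p = ∞ then
    if q = ∞ then
      ⨆ z ∈ Metric.ball (0 : ℂ) 1, ‖g z‖ₑ
    else
      (ENNReal.ofReal (1 / (2 * Real.pi)) *
        ∫⁻ t in Ico 0 (2 * Real.pi),
          (⨆ r ∈ Ico (0 : ℝ) 1, ‖g (polar r t)‖ₑ) ^ q.toReal) ^ (1 / q.toReal)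
  else
    if q = ∞ then
      essSup
        (fun t : ℝ => (∫⁻ r in Ico (0 : ℝ) 1, ‖g (polar r t)‖ₑ ^ p.toReal) ^ (1 / p.toReal))
        (volume.restrict (Ico 0 (2 * Real.pi)))
    else
      (ENNReal.ofReal (1 / (2 * Real.pi)) *
        ∫⁻ t in Ico 0 (2 * Real.pi),
          (∫⁻ r in Ico (0 : ℝ) 1, ‖g (polar r t)‖ₑ ^ p.toReal) ^ (q.toReal / p.toReal))
        ^ (1 / q.toReal)

/-- The space `RM(p,q)` of functions holomorphic on the open unit disc with finite `ρ_{p,q}`. -/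
def RM (p q : ℝ≥0∞) : Set (ℂ → ℂ) :=
  {f | DifferentiableOn ℂ f (Metric.ball 0 1) ∧ rho p q f < ∞}

end AvgRadial

end

/-! For finite `p` the engine is Cauchy's formula for `f'` at `r e^{it}` on the circle of radius `(1
+ r) / 2`. The factor `1 - r` turns the kernel `|w - z|⁻²` into a multiple of the Poisson kernel, so
`|f'| (1 - r)` is at most twice a Poisson average in the angle of `|f|` at radius `(1 + r) / 2`
(`enorm_deriv_mul_le_lintegral`). The change of radius only costs a factor 2 in the radial integral.
What remains is the boundedness on `L^q(dt; L^p(dr))` of a family of averages whose kernel depends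
on `r`.

This holds for any symmetric sub-Markov kernels whose maximal operator is bounded on all `L^s`, `s >
1` (`IsMaximalKernel`). If `p ≤ q`, Jensen's inequality reduces to averages of `g ^ p`; testing
against `w` in the space dual to `L^{q/p}`, symmetry moves the average onto `w`, where the maximal
theorem applies. If `1 < q < p`, Hölder's inequality with a power of `G ≈ (∫ g^p)^{1/p}` as weight
splits the average into a factor controlled by mass and symmetry and a factor controlled by the
maximal theorem. For the Poisson kernel the maximal bound comes from the Hardy–Littlewood theorem on
the line.

For `p = ∞`, `q < ∞` the endpoint `q = 1` rules out applying the maximal theorem to `|f|` itself.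
Instead `|f| ^ (1/2)` satisfies a mean value inequality over discs, so near `r e^{it}` it is bounded
by the maximal function of the square root of the radial supremum. Cauchy's estimate transfers this
to `f'`, and after squaring the maximal theorem is needed only in `L^{2q}`, with `2q > 1`. The case
`p = q = ∞` is Cauchy's estimate alone. -/

/-! ### Marcinkiewicz interpolation. -/

/-- A weak type estimate with truncated right-hand side yields a strong type estimate. -/
theorem lintegral_rpow_le_of_truncated_weak_type {α : Type*} [MeasurableSpace α] {μ : Measure α}
    {F w : α → ℝ≥0∞} (hF : Measurable F) (hw : Measurable w) {s : ℝ} (hs : 1 < s) {C : ℝ≥0∞}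
    (hC : C ≠ 0)
    (h : ∀ t : ℝ, 0 < t → ENNReal.ofReal t * μ {x | ENNReal.ofReal t < F x} ≤
      C * ∫⁻ x in {x | ENNReal.ofReal t < 2 * w x}, w x ∂μ) :
    ∫⁻ x, F x ^ s ∂μ ≤
      C * (ENNReal.ofReal s * (ENNReal.ofReal (s - 1))⁻¹ * 2 ^ (s - 1)) * ∫⁻ x, w x ^ s ∂μ := by
  have hs1 : 0 < s - 1 := by linarith
  have hs0 : 0 < s := by linarith
  have hnz : ENNReal.ofReal (s - 1) ≠ 0 := by simpa using hs1
  by_cases htop : ∫⁻ x, w x ^ s ∂μ = ∞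
  · rw [htop, ENNReal.mul_top]
    · exact le_top
    · have h2 : (2 : ℝ≥0∞) ^ (s - 1) ≠ 0 := by simp
      simp [hC, hs0]
  have hwfin : ∀ᵐ x ∂μ, w x < ∞ := by
    filter_upwards [ae_lt_top (hw.pow_const s) htop] with x hx
    exact (ENNReal.rpow_lt_top_iff_of_pos hs0).1 hx
  -- The truncated integral of `w` is the `ν`-measure of a superlevel set of `2 * w`, so the layer
  -- cake formula under `ν` yields `∫ (2w)^(s-1) w`, which is `2^(s-1) ∫ w^s`.
  set ν := μ.withDensity w with hν
  have hwfin' : ∀ᵐ x ∂ν, w x < ∞ := (withDensity_absolutelyContinuous μ w).ae_le hwfin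
  -- the layer cake formula for `w`
  have key : ENNReal.ofReal (s - 1) * ∫⁻ t in Ioi (0 : ℝ),
      ν {x | t < (2 * w x).toReal} * ENNReal.ofReal (t ^ (s - 1 - 1)) ≤
        2 ^ (s - 1) * ∫⁻ x, w x ^ s ∂μ := by
    rw [← lintegral_rpow_eq_lintegral_meas_lt_mul ν (Filter.Eventually.of_forall fun _ =>
      ENNReal.toReal_nonneg) (by fun_prop) hs1]
    rw [hν, lintegral_withDensity_eq_lintegral_mul _ hw (by fun_prop),
      ← lintegral_const_mul _ (by fun_prop)]
    refine lintegral_mono_ae ?_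
    filter_upwards [hwfin] with x hx
    have h2 : 2 * w x ≠ ∞ := ENNReal.mul_ne_top (by simp) hx.ne
    rw [Pi.mul_apply, ← ENNReal.ofReal_rpow_of_nonneg ENNReal.toReal_nonneg hs1.le,
      ENNReal.ofReal_toReal h2, ENNReal.mul_rpow_of_nonneg _ _ hs1.le]
    by_cases h0 : w x = 0
    · simp [h0]
    · have : w x ^ s = w x * w x ^ (s - 1) := by
        conv_lhs => rw [show s = 1 + (s - 1) by ring, ENNReal.rpow_add _ _ h0 hx.ne,
          ENNReal.rpow_one]
      rw [this]
      exact le_of_eq (by ring)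
  -- Cutting off at `n` makes the function finite, as the real-valued layer cake formula needs;
  -- monotone convergence then removes the cut-off.
  have trunc : ∀ n : ℕ, ∫⁻ x, (min (F x) n) ^ s ∂μ ≤
      C * (ENNReal.ofReal s * (ENNReal.ofReal (s - 1))⁻¹ * 2 ^ (s - 1)) * ∫⁻ x, w x ^ s ∂μ := by
    intro n
    have hfin : ∀ x, min (F x) n ≠ ∞ := fun x =>
      ne_top_of_le_ne_top (ENNReal.natCast_ne_top n) (min_le_right _ _)
    have e1 : ∫⁻ x, (min (F x) n) ^ s ∂μ =
        ∫⁻ x, ENNReal.ofReal ((min (F x) n).toReal ^ s) ∂μ := by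
      refine lintegral_congr fun x => ?_
      rw [← ENNReal.ofReal_rpow_of_nonneg ENNReal.toReal_nonneg hs0.le,
        ENNReal.ofReal_toReal (hfin x)]
    rw [e1, lintegral_rpow_eq_lintegral_meas_lt_mul μ (Filter.Eventually.of_forall fun _ =>
      ENNReal.toReal_nonneg) (by fun_prop) hs0]
    calc ENNReal.ofReal s * ∫⁻ t in Ioi (0 : ℝ),
          μ {x | t < (min (F x) n).toReal} * ENNReal.ofReal (t ^ (s - 1))
        ≤ ENNReal.ofReal s * ∫⁻ t in Ioi (0 : ℝ),
          C * (ν {x | t < (2 * w x).toReal} * ENNReal.ofReal (t ^ (s - 1 - 1))) := by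
          refine mul_le_mul_right (lintegral_mono_ae ?_) _
          filter_upwards [ae_restrict_mem measurableSet_Ioi] with t ht
          have ht : 0 < t := ht
          have hsplit : ENNReal.ofReal (t ^ (s - 1)) =
              ENNReal.ofReal t * ENNReal.ofReal (t ^ (s - 1 - 1)) := by
            rw [← ENNReal.ofReal_mul ht.le]
            congr 1
            conv_lhs => rw [show s - 1 = 1 + (s - 1 - 1) by ring, Real.rpow_add ht, Real.rpow_one]
          rw [hsplit, ← mul_assoc, ← mul_assoc]
          refine mul_le_mul_left ?_ _
          calc μ {x | t < (min (F x) n).toReal} * ENNReal.ofReal t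
              ≤ ENNReal.ofReal t * μ {x | ENNReal.ofReal t < F x} := by
                rw [mul_comm]
                refine mul_le_mul_right (measure_mono fun x hx => ?_) _
                exact lt_of_lt_of_le ((ENNReal.ofReal_lt_iff_lt_toReal ht.le (hfin x)).2 hx)
                  (min_le_left _ _)
            _ ≤ C * ∫⁻ x in {x | ENNReal.ofReal t < 2 * w x}, w x ∂μ := h t ht
            _ = C * ν {x | t < (2 * w x).toReal} := by
                congr 1
                rw [hν, ← withDensity_apply _ (measurableSet_lt measurable_const (by fun_prop))]
                refine measure_congr ?_
                filter_upwards [hwfin'] with x hx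
                have h2 : 2 * w x ≠ ∞ := ENNReal.mul_ne_top (by simp) hx.ne
                exact propext (ENNReal.ofReal_lt_iff_lt_toReal ht.le h2)
      _ = C * (ENNReal.ofReal s * (ENNReal.ofReal (s - 1))⁻¹) * (ENNReal.ofReal (s - 1) *
          ∫⁻ t in Ioi (0 : ℝ),
            ν {x | t < (2 * w x).toReal} * ENNReal.ofReal (t ^ (s - 1 - 1))) := by
          rw [lintegral_const_mul]
          · have : (ENNReal.ofReal (s - 1))⁻¹ * ENNReal.ofReal (s - 1) = 1 :=
              ENNReal.inv_mul_cancel hnz ENNReal.ofReal_ne_top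
            generalize (∫⁻ t in Ioi (0 : ℝ),
              ν {x | t < (2 * w x).toReal} * ENNReal.ofReal (t ^ (s - 1 - 1))) = I
            calc ENNReal.ofReal s * (C * I) = C * ENNReal.ofReal s * 1 * I := by ring
              _ = _ := by rw [← this]; ring
          · refine Measurable.mul ?_ (by fun_prop)
            exact Antitone.measurable fun a b hab => measure_mono fun x hx => lt_of_le_of_lt hab hx
      _ ≤ C * (ENNReal.ofReal s * (ENNReal.ofReal (s - 1))⁻¹) *
          (2 ^ (s - 1) * ∫⁻ x, w x ^ s ∂μ) := mul_le_mul_right key _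
      _ = _ := by ring
  have hsup : ∀ x, F x ^ s = ⨆ n : ℕ, (min (F x) n) ^ s := by
    intro x
    have : F x = ⨆ n : ℕ, min (F x) n := by
      rw [← inf_iSup_eq, ENNReal.iSup_natCast, inf_top_eq]
    conv_lhs => rw [this]
    exact (ENNReal.orderIsoRpow s hs0).map_iSup _
  simp_rw [hsup]
  rw [lintegral_iSup (fun n => by fun_prop)]
  · exact iSup_le trunc
  · intro m n hmn x
    exact ENNReal.rpow_le_rpow (min_le_min le_rfl (by exact_mod_cast hmn)) hs0.le

/-! ### Hardy–Littlewood maximal theorem on the line. -/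

/-- The uncentred Hardy–Littlewood maximal function on the line. -/
noncomputable def maximalFunction (w : ℝ → ℝ≥0∞) (x : ℝ) : ℝ≥0∞ :=
  ⨆ (c : ℝ) (a : ℝ) (_ : x ∈ Metric.ball c a),
    (∫⁻ y in Metric.ball c a, w y) / ENNReal.ofReal (2 * a)

theorem lintegral_ball_le_maximalFunction (w : ℝ → ℝ≥0∞) {x c a : ℝ} (h : x ∈ Metric.ball c a) :
    ∫⁻ y in Metric.ball c a, w y ≤ ENNReal.ofReal (2 * a) * maximalFunction w x := by
  have ha := Metric.pos_of_mem_ball h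
  have h0 : ENNReal.ofReal (2 * a) ≠ 0 := by simpa using ha
  rw [mul_comm, ← ENNReal.div_le_iff h0 ENNReal.ofReal_ne_top]
  exact le_iSup_of_le c (le_iSup_of_le a (le_iSup_of_le h le_rfl))

theorem lt_maximalFunction_iff (w : ℝ → ℝ≥0∞) (x : ℝ) (l : ℝ≥0∞) :
    l < maximalFunction w x ↔ ∃ c a : ℝ, x ∈ Metric.ball c a ∧
      l * ENNReal.ofReal (2 * a) < ∫⁻ y in Metric.ball c a, w y := by
  simp only [maximalFunction, lt_iSup_iff]
  constructor
  · rintro ⟨c, a, h, hl⟩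
    have ha := Metric.pos_of_mem_ball h
    refine ⟨c, a, h, ?_⟩
    rwa [ENNReal.lt_div_iff_mul_lt] at hl
    · left; simpa using ha
    · left; exact ENNReal.ofReal_ne_top
  · rintro ⟨c, a, h, hl⟩
    have ha := Metric.pos_of_mem_ball h
    refine ⟨c, a, h, ?_⟩
    rwa [ENNReal.lt_div_iff_mul_lt]
    · left; simpa using ha
    · left; exact ENNReal.ofReal_ne_top

/-- Balls are uncentred, so a ball witnessing the inequality at one point witnesses it at all its
points. This gives measurability of the maximal function with no assumption on `w`. -/
theorem isOpen_setOf_lt_maximalFunction (w : ℝ → ℝ≥0∞) (l : ℝ≥0∞) :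
    IsOpen {x | l < maximalFunction w x} := by
  rw [isOpen_iff_forall_mem_open]
  intro x hx
  obtain ⟨c, a, h, hl⟩ := (lt_maximalFunction_iff w x l).1 hx
  exact ⟨Metric.ball c a, fun y hy => (lt_maximalFunction_iff w y l).2 ⟨c, a, hy, hl⟩,
    Metric.isOpen_ball, h⟩

@[fun_prop]
theorem measurable_maximalFunction (w : ℝ → ℝ≥0∞) : Measurable (maximalFunction w) :=
  measurable_of_Ioi fun l => (isOpen_setOf_lt_maximalFunction w l).measurableSet

/-- The weak type `(1,1)` estimate for the maximal function. -/
theorem mul_volume_lt_maximalFunction_le (w : ℝ → ℝ≥0∞) {l : ℝ≥0∞} (hl : l ≠ 0) (hl' : l ≠ ∞) :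
    l * volume {x | l < maximalFunction w x} ≤ 4 * ∫⁻ y, w y := by
  by_cases hI : ∫⁻ y, w y = ∞
  · rw [hI, ENNReal.mul_top (by simp)]
    exact le_top
  set T : Set (ℝ × ℝ) := {i | 0 < i.2 ∧
    l * ENNReal.ofReal (2 * i.2) < ∫⁻ y in Metric.ball i.1 i.2, w y} with hT
  -- Finiteness of `∫ w` bounds the radii, as the Vitali covering lemma requires; its enlargement
  -- factor 4 is the constant of the weak type bound.
  have hR : ∀ i ∈ T, i.2 ≤ ((∫⁻ y, w y) / l).toReal := by
    rintro ⟨c, a⟩ ⟨ha, h⟩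
    have h1 : l * ENNReal.ofReal (2 * a) ≤ ∫⁻ y, w y :=
      h.le.trans (setLIntegral_le_lintegral _ _)
    have h2 : ENNReal.ofReal (2 * a) ≤ (∫⁻ y, w y) / l := by
      rw [ENNReal.le_div_iff_mul_le (Or.inl hl) (Or.inl hl'), mul_comm]
      exact h1
    have h3 := (ENNReal.ofReal_le_iff_le_toReal (ENNReal.div_ne_top hI hl)).1 h2
    simp only at ha ⊢
    linarith
  obtain ⟨u, huT, hdisj, hcov⟩ := Vitali.exists_disjoint_subfamily_covering_enlargement_closedBall
    T Prod.fst Prod.snd _ hR 4 (by norm_num)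
  have hu : u.Countable := by
    refine hdisj.countable_of_nonempty_interior fun i hi => ?_
    refine ⟨i.1, ?_⟩
    exact interior_mono Metric.ball_subset_closedBall
      (by simpa [Metric.isOpen_ball.interior_eq] using (huT hi).1)
  have : Countable u := hu
  have hsub : {x | l < maximalFunction w x} ⊆ ⋃ i ∈ u, Metric.closedBall i.1 (4 * i.2) := by
    intro x hx
    obtain ⟨c, a, h, hl⟩ := (lt_maximalFunction_iff w x l).1 hx
    obtain ⟨b, hb, hsub⟩ := hcov (c, a) ⟨Metric.pos_of_mem_ball h, hl⟩
    exact mem_iUnion₂.2 ⟨b, hb, hsub (Metric.ball_subset_closedBall h)⟩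
  calc l * volume {x | l < maximalFunction w x}
      ≤ l * ∑' i : u, volume (Metric.closedBall i.1.1 (4 * i.1.2)) := by
        refine mul_le_mul_right ((measure_mono hsub).trans ?_) _
        exact measure_biUnion_le _ hu _
    _ = ∑' i : u, l * volume (Metric.closedBall i.1.1 (4 * i.1.2)) := ENNReal.tsum_mul_left.symm
    _ ≤ ∑' i : u, 4 * ∫⁻ y in Metric.ball i.1.1 i.1.2, w y := by
        refine ENNReal.tsum_le_tsum fun i => ?_
        have := (huT i.2).2.le
        rw [Real.volume_closedBall, show 2 * (4 * i.1.2) = 4 * (2 * i.1.2) by ring,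
          ENNReal.ofReal_mul (by norm_num), ← mul_assoc, mul_comm l, mul_assoc,
          show ENNReal.ofReal 4 = 4 by norm_num]
        exact mul_le_mul_right this _
    _ = 4 * ∑' i : u, ∫⁻ y in Metric.ball i.1.1 i.1.2, w y := ENNReal.tsum_mul_left
    _ = 4 * ∫⁻ y in ⋃ i ∈ u, Metric.ball i.1 i.2, w y := by
        rw [lintegral_biUnion hu (fun i _ => measurableSet_ball)]
        exact hdisj.mono fun i => Metric.ball_subset_closedBall
    _ ≤ 4 * ∫⁻ y, w y := mul_le_mul_right (setLIntegral_le_lintegral _ _) _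

/-- The Hardy–Littlewood maximal theorem on the line. -/
theorem exists_lintegral_maximalFunction_rpow_le {s : ℝ} (hs : 1 < s) :
    ∃ C : ℝ≥0, ∀ w : ℝ → ℝ≥0∞, Measurable w →
      ∫⁻ x, maximalFunction w x ^ s ≤ C * ∫⁻ x, w x ^ s := by
  have hfin : 8 * (ENNReal.ofReal s * (ENNReal.ofReal (s - 1))⁻¹ * 2 ^ (s - 1)) ≠ ∞ := by
    have : (ENNReal.ofReal (s - 1))⁻¹ ≠ ∞ := by simpa using hs
    have h2 : (2 : ℝ≥0∞) ^ (s - 1) ≠ ∞ := by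
      apply ENNReal.rpow_ne_top_of_nonneg (by linarith) (by simp)
    exact ENNReal.mul_ne_top (by simp) (ENNReal.mul_ne_top
      (ENNReal.mul_ne_top ENNReal.ofReal_ne_top this) h2)
  refine ⟨ENNReal.toNNReal (8 * (ENNReal.ofReal s * (ENNReal.ofReal (s - 1))⁻¹ * 2 ^ (s - 1))),
    fun w hw => ?_⟩
  · rw [ENNReal.coe_toNNReal hfin]
    refine lintegral_rpow_le_of_truncated_weak_type (measurable_maximalFunction w) hw hs
      (C := 8) (by simp) ?_
    intro t ht
    -- Off `A` the function is at most `t / 2`, which adds at most `t / 2` to any average. Hence `Mw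
    -- > t` forces `M(w 1_A) > t / 2`, and the constant is `8 = 2 * 4`.
    set A := {x | ENNReal.ofReal t < 2 * w x} with hA
    have hAm : MeasurableSet A := measurableSet_lt measurable_const (by fun_prop)
    have hle : ∀ x, w x ≤ A.indicator w x + ENNReal.ofReal (t / 2) := by
      intro x
      by_cases hx : x ∈ A
      · simp [hx]
      · have hx' : 2 * w x ≤ ENNReal.ofReal t := not_lt.1 hx
        rw [indicator_of_notMem hx, zero_add, ENNReal.ofReal_div_of_pos (by norm_num),
          ENNReal.le_div_iff_mul_le (by simp) (by simp), mul_comm]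
        simpa using hx'
    have hsub : {x | ENNReal.ofReal t < maximalFunction w x} ⊆
        {x | ENNReal.ofReal (t / 2) < maximalFunction (A.indicator w) x} := by
      intro x hx
      obtain ⟨c, a, h, hl⟩ := (lt_maximalFunction_iff w x _).1 hx
      refine (lt_maximalFunction_iff _ x _).2 ⟨c, a, h, ?_⟩
      by_contra! hcon
      refine hl.not_ge ?_
      calc ∫⁻ y in Metric.ball c a, w y
          ≤ ∫⁻ y in Metric.ball c a, (A.indicator w y + ENNReal.ofReal (t / 2)) :=
            lintegral_mono fun y => hle y
        _ = (∫⁻ y in Metric.ball c a, A.indicator w y) +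
            ENNReal.ofReal (t / 2) * ENNReal.ofReal (2 * a) := by
            rw [lintegral_add_right _ measurable_const, setLIntegral_const, Real.volume_ball]
        _ ≤ ENNReal.ofReal (t / 2) * ENNReal.ofReal (2 * a) +
            ENNReal.ofReal (t / 2) * ENNReal.ofReal (2 * a) := by gcongr
        _ = ENNReal.ofReal t * ENNReal.ofReal (2 * a) := by
            rw [← add_mul, ← ENNReal.ofReal_add (by positivity) (by positivity)]
            congr 2; ring
    have hweak := mul_volume_lt_maximalFunction_le (A.indicator w) (l := ENNReal.ofReal (t / 2))
      (by simpa using ht) ENNReal.ofReal_ne_top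
    rw [lintegral_indicator hAm] at hweak
    calc ENNReal.ofReal t * volume {x | ENNReal.ofReal t < maximalFunction w x}
        ≤ ENNReal.ofReal t *
          volume {x | ENNReal.ofReal (t / 2) < maximalFunction (A.indicator w) x} :=
          mul_le_mul_right (measure_mono hsub) _
      _ = 2 * (ENNReal.ofReal (t / 2) *
          volume {x | ENNReal.ofReal (t / 2) < maximalFunction (A.indicator w) x}) := by
          rw [← mul_assoc]
          congr 1
          rw [show (2 : ℝ≥0∞) = ENNReal.ofReal 2 by norm_num, ← ENNReal.ofReal_mul (by norm_num)]
          congr 1; ring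
      _ ≤ 2 * (4 * ∫⁻ y in A, w y) := mul_le_mul_right hweak _
      _ = 8 * ∫⁻ y in A, w y := by rw [← mul_assoc]; norm_num

/-! ### Hölder, Jensen and duality for nonnegative functions. -/

/-- Weighted Hölder inequality against a kernel. -/
theorem lintegral_mul_mul_rpow_le {α : Type*} [MeasurableSpace α] {μ : Measure α}
    {k a b : α → ℝ≥0∞} (hk : Measurable k) (ha : Measurable a) (hb : Measurable b) {p : ℝ}
    (hp : 1 < p) :
    (∫⁻ x, k x * (a x * b x) ∂μ) ^ p ≤
      (∫⁻ x, k x * a x ^ p ∂μ) * (∫⁻ x, k x * b x ^ (p / (p - 1)) ∂μ) ^ (p - 1) := by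
  have hp0 : 0 < p := by linarith
  have hp1 : 0 < p - 1 := by linarith
  have hpq : p.HolderConjugate (p / (p - 1)) := Real.HolderConjugate.conjExponent hp
  have h := ENNReal.lintegral_mul_le_Lp_mul_Lq (μ.withDensity k) hpq ha.aemeasurable hb.aemeasurable
  rw [lintegral_withDensity_eq_lintegral_mul _ hk (ha.mul hb),
    lintegral_withDensity_eq_lintegral_mul _ hk (by fun_prop),
    lintegral_withDensity_eq_lintegral_mul _ hk (by fun_prop)] at h
  refine (ENNReal.rpow_le_rpow h hp0.le).trans (le_of_eq ?_)
  rw [ENNReal.mul_rpow_of_nonneg _ _ hp0.le, ← ENNReal.rpow_mul, ← ENNReal.rpow_mul]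
  rw [one_div_mul_cancel hp0.ne', ENNReal.rpow_one,
    show 1 / (p / (p - 1)) * p = p - 1 by field_simp]
  rfl

/-- Jensen's inequality for a sub-probability density. -/
theorem lintegral_mul_rpow_le_of_lintegral_le_one {α : Type*} [MeasurableSpace α] {μ : Measure α}
    {k a : α → ℝ≥0∞} (hk : Measurable k) (ha : Measurable a) (hk1 : ∫⁻ x, k x ∂μ ≤ 1) {p : ℝ}
    (hp : 1 ≤ p) : (∫⁻ x, k x * a x ∂μ) ^ p ≤ ∫⁻ x, k x * a x ^ p ∂μ := by
  rcases hp.eq_or_lt with rfl | hp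
  · simp
  have h := lintegral_mul_mul_rpow_le (μ := μ) hk ha (measurable_const (a := 1)) hp
  simp only [mul_one, ENNReal.one_rpow] at h
  refine h.trans ((mul_le_mul_right (ENNReal.rpow_le_one hk1 (by linarith)) _).trans ?_)
  rw [mul_one]

/-- Converse of Hölder's inequality for nonnegative functions on a finite measure space. -/
theorem lintegral_rpow_le_of_forall_lintegral_mul_le {α : Type*} [MeasurableSpace α]
    {μ : Measure α} [IsFiniteMeasure μ] {F : α → ℝ≥0∞} (hF : Measurable F) {s : ℝ} (hs : 1 < s)
    {A : ℝ≥0∞} (h : ∀ w : α → ℝ≥0∞, Measurable w →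
      ∫⁻ x, F x * w x ∂μ ≤ A * (∫⁻ x, w x ^ (s / (s - 1)) ∂μ) ^ ((s - 1) / s)) :
    ∫⁻ x, F x ^ s ∂μ ≤ A ^ s := by
  have hs0 : 0 < s := by linarith
  have hs1 : 0 < s - 1 := by linarith
  have trunc : ∀ n : ℕ, ∫⁻ x, (min (F x) n) ^ s ∂μ ≤ A ^ s := by
    intro n
    set I := ∫⁻ x, (min (F x) n) ^ s ∂μ with hI
    have hfin : I ≠ ∞ := by
      refine ne_top_of_le_ne_top (b := ∫⁻ _, (n : ℝ≥0∞) ^ s ∂μ) ?_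
        (lintegral_mono fun x => ENNReal.rpow_le_rpow (min_le_right _ _) hs0.le)
      rw [lintegral_const]
      exact ENNReal.mul_ne_top (ENNReal.rpow_ne_top_of_nonneg hs0.le (ENNReal.natCast_ne_top n))
        (measure_ne_top μ _)
    -- The test function is the extremal `min(F, n)^(s-1)`; the truncation keeps `I` finite, so that
    -- a power of it can be cancelled.
    have h1 : I ≤ A * I ^ ((s - 1) / s) := by
      refine le_trans ?_ ((h (fun x => (min (F x) n) ^ (s - 1)) (by fun_prop)).trans (le_of_eq ?_))
      · refine lintegral_mono fun x => ?_
        have : (min (F x) n) ^ s = min (F x) n * (min (F x) n) ^ (s - 1) := by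
          conv_lhs => rw [show s = 1 + (s - 1) by ring,
            ENNReal.rpow_add_of_nonneg _ _ zero_le_one hs1.le, ENNReal.rpow_one]
        rw [this]
        exact mul_le_mul_left (min_le_left _ _) _
      · simp_rw [← ENNReal.rpow_mul]
        rw [show (s - 1) * (s / (s - 1)) = s by field_simp]
    by_cases h0 : I = 0
    · rw [h0]; exact zero_le
    have h2 : I ^ (1 / s) ≤ A := by
      have hne : I ^ ((s - 1) / s) ≠ 0 := by simp [h0, hfin]
      have hne' : I ^ ((s - 1) / s) ≠ ∞ := by simp [h0, hfin]
      rw [← ENNReal.mul_le_mul_iff_left hne hne', ← ENNReal.rpow_add _ _ h0 hfin]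
      rw [show 1 / s + (s - 1) / s = 1 by field_simp; ring, ENNReal.rpow_one]
      exact h1
    calc I = (I ^ (1 / s)) ^ s := by
          rw [← ENNReal.rpow_mul, one_div_mul_cancel hs0.ne', ENNReal.rpow_one]
      _ ≤ A ^ s := ENNReal.rpow_le_rpow h2 hs0.le
  have hsup : ∀ x, F x ^ s = ⨆ n : ℕ, (min (F x) n) ^ s := by
    intro x
    have : F x = ⨆ n : ℕ, min (F x) n := by
      rw [← inf_iSup_eq, ENNReal.iSup_natCast, inf_top_eq]
    conv_lhs => rw [this]
    exact (ENNReal.orderIsoRpow s hs0).map_iSup _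
  simp_rw [hsup]
  rw [lintegral_iSup (fun n => by fun_prop)]
  · exact iSup_le trunc
  · intro m n hmn x
    exact ENNReal.rpow_le_rpow (min_le_min le_rfl (by exact_mod_cast hmn)) hs0.le

/-! ### Symmetric averaging kernels on mixed norm spaces. -/

/-- A measurable family `K y` of symmetric sub-Markov kernels on `X` whose maximal operator is
bounded on `L^s` for all `s > 1`. -/
structure IsMaximalKernel {X Y : Type*} [MeasurableSpace X] [MeasurableSpace Y]
    (K : Y → X → X → ℝ≥0∞) (μ : Measure X) : Prop where
  measurable : Measurable fun z : (Y × X) × X => K z.1.1 z.1.2 z.2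
  symm : ∀ y x x', K y x x' = K y x' x
  mass_le_one : ∀ y x, ∫⁻ x', K y x x' ∂μ ≤ 1
  maximal : ∀ s : ℝ, 1 < s → ∃ C : ℝ≥0, ∀ w : X → ℝ≥0∞, Measurable w →
    ∃ m : X → ℝ≥0∞, Measurable m ∧ (∀ y x, ∫⁻ x', K y x x' * w x' ∂μ ≤ m x) ∧
      ∫⁻ x, m x ^ s ∂μ ≤ C * ∫⁻ x, w x ^ s ∂μ

namespace IsMaximalKernel

variable {X Y : Type*} [MeasurableSpace X] [MeasurableSpace Y] {K : Y → X → X → ℝ≥0∞}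
  {μ : Measure X}

theorem measurable_lintegral_mul [SFinite μ] (hK : IsMaximalKernel K μ) {g : Y → X → ℝ≥0∞}
    (hg : Measurable (Function.uncurry g)) :
    Measurable fun z : Y × X => ∫⁻ x', K z.1 z.2 x' * g z.1 x' ∂μ := by
  refine Measurable.lintegral_prod_right' (f := fun z : (Y × X) × X =>
    K z.1.1 z.1.2 z.2 * g z.1.1 z.2) ?_
  exact hK.measurable.mul (hg.comp (measurable_fst.fst.prodMk measurable_snd))

theorem measurable_right (hK : IsMaximalKernel K μ) (y : Y) (x : X) : Measurable (K y x) :=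
  hK.measurable.comp (f := fun x' => ((y, x), x')) (by fun_prop)

/-- Duality estimate: averages of `g` tested against `w` are averages of `w` tested against `g`. -/
theorem lintegral_lintegral_mul_le [SFinite μ] (hK : IsMaximalKernel K μ) {ν : Measure Y}
    [SFinite ν] {g : Y → X → ℝ≥0∞} (hg : Measurable (Function.uncurry g)) {w m : X → ℝ≥0∞}
    (hw : Measurable w) (hm : Measurable m) (hwm : ∀ y x, ∫⁻ x', K y x x' * w x' ∂μ ≤ m x) :
    ∫⁻ x, (∫⁻ y, ∫⁻ x', K y x x' * g y x' ∂μ ∂ν) * w x ∂μ ≤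
      ∫⁻ x, (∫⁻ y, g y x ∂ν) * m x ∂μ := by
  have hT := hK.measurable_lintegral_mul hg
  have hgy : ∀ y, Measurable (g y) := fun y => hg.comp (f := fun x => (y, x)) (by fun_prop)
  have hgx : ∀ x, Measurable fun y => g y x := fun x => hg.comp (f := fun y => (y, x)) (by fun_prop)
  calc ∫⁻ x, (∫⁻ y, ∫⁻ x', K y x x' * g y x' ∂μ ∂ν) * w x ∂μ
      = ∫⁻ x, ∫⁻ y, (∫⁻ x', K y x x' * g y x' ∂μ) * w x ∂ν ∂μ := by
        refine lintegral_congr fun x => ?_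
        rw [lintegral_mul_const]
        exact hT.comp (f := fun y => (y, x)) (by fun_prop)
    _ = ∫⁻ y, ∫⁻ x, (∫⁻ x', K y x x' * g y x' ∂μ) * w x ∂μ ∂ν := by
        rw [lintegral_lintegral_swap]
        refine Measurable.aemeasurable ?_
        exact (hT.comp (f := fun z : X × Y => (z.2, z.1)) (by fun_prop)).mul
          (hw.comp measurable_fst)
    -- Symmetry of `K y` moves the average from `g y` to `w`.
    _ = ∫⁻ y, ∫⁻ x', g y x' * ∫⁻ x, K y x' x * w x ∂μ ∂μ ∂ν := by
        refine lintegral_congr fun y => ?_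
        have h1 : Measurable (Function.uncurry fun x x' : X => K y x x' * g y x' * w x) :=
          ((hK.measurable.comp (f := fun z : X × X => ((y, z.1), z.2)) (by fun_prop)).mul
            ((hgy y).comp measurable_snd)).mul (hw.comp measurable_fst)
        calc ∫⁻ x, (∫⁻ x', K y x x' * g y x' ∂μ) * w x ∂μ
            = ∫⁻ x, ∫⁻ x', K y x x' * g y x' * w x ∂μ ∂μ := by
              refine lintegral_congr fun x => ?_
              exact (lintegral_mul_const _ ((hK.measurable_right y x).mul (hgy y))).symm
          _ = ∫⁻ x', ∫⁻ x, K y x x' * g y x' * w x ∂μ ∂μ :=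
              lintegral_lintegral_swap h1.aemeasurable
          _ = ∫⁻ x', g y x' * ∫⁻ x, K y x' x * w x ∂μ ∂μ := by
              refine lintegral_congr fun x' => ?_
              refine Eq.trans ?_ (lintegral_const_mul _ ((hK.measurable_right y x').mul hw))
              refine lintegral_congr fun x => ?_
              rw [hK.symm y x x']
              ring
    _ ≤ ∫⁻ y, ∫⁻ x', g y x' * m x' ∂μ ∂ν :=
        lintegral_mono fun y => lintegral_mono fun x' => mul_le_mul_right (hwm y x') _
    _ = ∫⁻ x', ∫⁻ y, g y x' * m x' ∂ν ∂μ :=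
        lintegral_lintegral_swap (hg.mul (hm.comp measurable_snd)).aemeasurable
    _ = ∫⁻ x, (∫⁻ y, g y x ∂ν) * m x ∂μ :=
        lintegral_congr fun x => lintegral_mul_const _ (hgx x)

/-- Boundedness of the averages on the mixed norm space `L^q(L^p)` for `1 ≤ p ≤ q`. -/
theorem exists_mixedNorm_le_of_le [IsFiniteMeasure μ] (hK : IsMaximalKernel K μ) {ν : Measure Y}
    [SFinite ν] {p q : ℝ} (hp : 1 ≤ p) (hpq : p ≤ q) :
    ∃ C : ℝ≥0, ∀ g : Y → X → ℝ≥0∞, Measurable (Function.uncurry g) →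
      ∫⁻ x, (∫⁻ y, (∫⁻ x', K y x x' * g y x' ∂μ) ^ p ∂ν) ^ (q / p) ∂μ ≤
        C * ∫⁻ x, (∫⁻ y, g y x ^ p ∂ν) ^ (q / p) ∂μ := by
  have hp0 : 0 < p := by linarith
  have jensen : ∀ g : Y → X → ℝ≥0∞, Measurable (Function.uncurry g) → ∀ x,
      ∫⁻ y, (∫⁻ x', K y x x' * g y x' ∂μ) ^ p ∂ν ≤
        ∫⁻ y, ∫⁻ x', K y x x' * g y x' ^ p ∂μ ∂ν := fun g hg x =>
    lintegral_mono fun y => lintegral_mul_rpow_le_of_lintegral_le_one (hK.measurable_right y x)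
      (hg.comp (f := fun x => (y, x)) (by fun_prop)) (hK.mass_le_one y x) hp
  rcases hpq.eq_or_lt with rfl | hpq
  -- On the diagonal `p = q`, mass and symmetry suffice. No maximal theorem is needed, so `p = q =
  -- 1` is included.
  · refine ⟨1, fun g hg => ?_⟩
    simp only [div_self hp0.ne', ENNReal.rpow_one, ENNReal.coe_one, one_mul]
    refine (lintegral_mono (jensen g hg)).trans ?_
    simpa using hK.lintegral_lintegral_mul_le (ν := ν) (g := fun y x => g y x ^ p)
      (hg.pow_const p) (w := fun _ => 1) (m := fun _ => 1) measurable_const measurable_const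
      (fun y x => by simpa using hK.mass_le_one y x)
  · set s := q / p with hs
    have hs1 : 1 < s := (one_lt_div hp0).2 hpq
    have hs0 : 0 < s := by linarith
    have hs1' : 0 < s - 1 := by linarith
    obtain ⟨C, hC⟩ := hK.maximal (s / (s - 1)) ((one_lt_div hs1').2 (by linarith))
    refine ⟨(C ^ ((s - 1) / s)) ^ s, fun g hg => ?_⟩
    have hG : Measurable fun x => ∫⁻ y, g y x ^ p ∂ν :=
      Measurable.lintegral_prod_left' (f := fun z : Y × X => g z.1 z.2 ^ p) (hg.pow_const p)
    have hF : Measurable fun x => ∫⁻ y, (∫⁻ x', K y x x' * g y x' ∂μ) ^ p ∂ν :=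
      Measurable.lintegral_prod_left' (f := fun z : Y × X =>
        (∫⁻ x', K z.1 z.2 x' * g z.1 x' ∂μ) ^ p) ((hK.measurable_lintegral_mul hg).pow_const p)
    set I := ∫⁻ x, (∫⁻ y, g y x ^ p ∂ν) ^ s ∂μ with hI
    have main : ∫⁻ x, (∫⁻ y, (∫⁻ x', K y x x' * g y x' ∂μ) ^ p ∂ν) ^ s ∂μ ≤
        (C ^ ((s - 1) / s) * I ^ (1 / s)) ^ s := by
      refine lintegral_rpow_le_of_forall_lintegral_mul_le hF hs1 fun w hw => ?_
      obtain ⟨m, hm, hwm, hmC⟩ := hC w hw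
      calc ∫⁻ x, (∫⁻ y, (∫⁻ x', K y x x' * g y x' ∂μ) ^ p ∂ν) * w x ∂μ
          ≤ ∫⁻ x, (∫⁻ y, ∫⁻ x', K y x x' * g y x' ^ p ∂μ ∂ν) * w x ∂μ :=
            lintegral_mono fun x => mul_le_mul_left (jensen g hg x) _
        _ ≤ ∫⁻ x, (∫⁻ y, g y x ^ p ∂ν) * m x ∂μ :=
            hK.lintegral_lintegral_mul_le (g := fun y x => g y x ^ p) (hg.pow_const p) hw hm hwm
        _ ≤ I ^ (1 / s) * (∫⁻ x, m x ^ (s / (s - 1)) ∂μ) ^ (1 / (s / (s - 1))) :=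
            ENNReal.lintegral_mul_le_Lp_mul_Lq μ (Real.HolderConjugate.conjExponent hs1)
              hG.aemeasurable hm.aemeasurable
        _ ≤ I ^ (1 / s) * (C * ∫⁻ x, w x ^ (s / (s - 1)) ∂μ) ^ ((s - 1) / s) := by
            rw [one_div_div s]
            exact mul_le_mul_right (ENNReal.rpow_le_rpow hmC (by positivity)) _
        _ = _ := by
            rw [ENNReal.mul_rpow_of_nonneg _ _ (by positivity)]
            ring
    refine main.trans (le_of_eq ?_)
    rw [ENNReal.mul_rpow_of_nonneg _ _ hs0.le, ← ENNReal.rpow_mul I, one_div_mul_cancel hs0.ne',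
      ENNReal.rpow_one, ENNReal.coe_rpow_of_nonneg _ hs0.le,
      ENNReal.coe_rpow_of_nonneg _ (by positivity)]

/-- Domination of the mixed norm of the averages by an auxiliary majorant, for `1 < q < p`. -/
theorem exists_mixedNorm_le_majorant [IsFiniteMeasure μ] (hK : IsMaximalKernel K μ)
    {ν : Measure Y} [SFinite ν] {p q : ℝ} (hq : 1 < q) (hqp : q < p) :
    ∃ C : ℝ≥0, ∀ g : Y → X → ℝ≥0∞, Measurable (Function.uncurry g) →
      ∀ G : X → ℝ≥0∞, Measurable G → (∀ᵐ x ∂μ, G x ≠ 0 ∧ G x ≠ ∞) →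
      (∀ x, ∫⁻ y, g y x ^ p ∂ν ≤ G x ^ p) →
      ∫⁻ x, (∫⁻ y, (∫⁻ x', K y x x' * g y x' ∂μ) ^ p ∂ν) ^ (q / p) ∂μ ≤
        C * ∫⁻ x, G x ^ q ∂μ := by
  have hp : 1 < p := by linarith
  have hp0 : 0 < p := by linarith
  have hq0 : 0 < q := by linarith
  have hp1 : 0 < p - 1 := by linarith
  have hd : 0 < p - q := by linarith
  -- Raising the weight `G^((p-q)/p)` to the conjugate exponent `p/(p-1)` gives `G^a`. The maximal
  -- theorem is used on `G^a` with exponent `q / a`, which exceeds 1 exactly because `q > 1`.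
  set a := (p - q) / (p - 1) with ha
  have ha0 : 0 < a := by positivity
  have hqa : 1 < q / a := by
    rw [one_lt_div ha0, ha, div_lt_iff₀ hp1]
    nlinarith
  obtain ⟨C, hC⟩ := hK.maximal (q / a) hqa
  refine ⟨C ^ ((p - q) / p), fun g hg G hG hGfin hgG => ?_⟩
  obtain ⟨m, hm, hwm, hmC⟩ := hC (fun x => G x ^ a) (by fun_prop)
  set h : Y → X → ℝ≥0∞ := fun y x => g y x ^ p * G x ^ (-(p - q)) with hh
  have hhm : Measurable (Function.uncurry h) :=
    (hg.pow_const p).mul ((hG.comp measurable_snd).pow_const _)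
  have hgy : ∀ y, Measurable (g y) := fun y => hg.comp (f := fun x => (y, x)) (by fun_prop)
  set S : X → ℝ≥0∞ := fun x => ∫⁻ y, ∫⁻ x', K y x x' * h y x' ∂μ ∂ν with hS
  have hSm : Measurable S := Measurable.lintegral_prod_left' (f := fun z : Y × X =>
        ∫⁻ x', K z.1 z.2 x' * h z.1 x' ∂μ) (hK.measurable_lintegral_mul hhm)
  have step1 : ∀ x, ∫⁻ y, (∫⁻ x', K y x x' * g y x' ∂μ) ^ p ∂ν ≤ S x * m x ^ (p - 1) := by
    intro x
    rw [hS, ← lintegral_mul_const]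
    swap
    · exact (hK.measurable_lintegral_mul hhm).comp (f := fun y => (y, x)) (by fun_prop)
    refine lintegral_mono fun y => ?_
    calc (∫⁻ x', K y x x' * g y x' ∂μ) ^ p
        = (∫⁻ x', K y x x' * ((g y x' * G x' ^ (-((p - q) / p))) * G x' ^ ((p - q) / p)) ∂μ) ^ p := by
          congr 1
          refine lintegral_congr_ae ?_
          filter_upwards [hGfin] with x' hx'
          rw [mul_assoc (g y x'), ← ENNReal.rpow_add _ _ hx'.1 hx'.2]
          simp
      _ ≤ (∫⁻ x', K y x x' * (g y x' * G x' ^ (-((p - q) / p))) ^ p ∂μ) *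
          (∫⁻ x', K y x x' * (G x' ^ ((p - q) / p)) ^ (p / (p - 1)) ∂μ) ^ (p - 1) :=
          lintegral_mul_mul_rpow_le (hK.measurable_right y x) ((hgy y).mul (by fun_prop))
            (by fun_prop) hp
      _ ≤ (∫⁻ x', K y x x' * h y x' ∂μ) * m x ^ (p - 1) := by
          refine mul_le_mul' (le_of_eq ?_) (ENNReal.rpow_le_rpow ?_ hp1.le)
          · refine lintegral_congr fun x' => ?_
            rw [ENNReal.mul_rpow_of_nonneg _ _ hp0.le, ← ENNReal.rpow_mul, hh]
            congr 3
            field_simp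
          · refine (le_of_eq ?_).trans (hwm y x)
            refine lintegral_congr fun x' => ?_
            rw [← ENNReal.rpow_mul, ha]
            congr 2
            field_simp
  -- Mass and symmetry remove the average, leaving `∫ G^p G^(q-p)`.
  have step2 : ∫⁻ x, S x ∂μ ≤ ∫⁻ x, G x ^ q ∂μ := by
    have := hK.lintegral_lintegral_mul_le (ν := ν) hhm (w := fun _ => 1) (m := fun _ => 1)
      measurable_const measurable_const (fun y x => by simpa using hK.mass_le_one y x)
    simp only [mul_one] at this
    refine this.trans (lintegral_mono_ae ?_)
    filter_upwards [hGfin] with x hx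
    have hgx : Measurable fun y => g y x := hg.comp (f := fun y => (y, x)) (by fun_prop)
    simp only [hh]
    rw [lintegral_mul_const _ (hgx.pow_const p)]
    refine (mul_le_mul_left (hgG x) _).trans (le_of_eq ?_)
    rw [← ENNReal.rpow_add _ _ hx.1 hx.2]
    congr 1
    ring
  have hconj : (p / q).HolderConjugate (p / (p - q)) := by
    rw [Real.holderConjugate_iff]
    refine ⟨(one_lt_div hq0).2 hqp, ?_⟩
    field_simp
    ring
  set I := ∫⁻ x, G x ^ q ∂μ with hI
  calc ∫⁻ x, (∫⁻ y, (∫⁻ x', K y x x' * g y x' ∂μ) ^ p ∂ν) ^ (q / p) ∂μ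
      ≤ ∫⁻ x, S x ^ (q / p) * m x ^ ((p - 1) * (q / p)) ∂μ := by
        refine lintegral_mono fun x => ?_
        rw [ENNReal.rpow_mul, ← ENNReal.mul_rpow_of_nonneg _ _ (by positivity)]
        exact ENNReal.rpow_le_rpow (step1 x) (by positivity)
    _ ≤ (∫⁻ x, (S x ^ (q / p)) ^ (p / q) ∂μ) ^ (1 / (p / q)) *
        (∫⁻ x, (m x ^ ((p - 1) * (q / p))) ^ (p / (p - q)) ∂μ) ^ (1 / (p / (p - q))) :=
        ENNReal.lintegral_mul_le_Lp_mul_Lq μ hconj (hSm.pow_const _).aemeasurable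
          (hm.pow_const _).aemeasurable
    _ = (∫⁻ x, S x ∂μ) ^ (q / p) * (∫⁻ x, m x ^ (q / a) ∂μ) ^ ((p - q) / p) := by
        simp_rw [← ENNReal.rpow_mul, one_div_div]
        rw [show q / p * (p / q) = 1 by field_simp,
          show (p - 1) * (q / p) * (p / (p - q)) = q / a by rw [ha]; field_simp]
        simp
    _ ≤ I ^ (q / p) * (C * I) ^ ((p - q) / p) := by
        have hmC' : ∫⁻ x, m x ^ (q / a) ∂μ ≤ C * I := by
          refine hmC.trans (le_of_eq ?_)
          simp_rw [← ENNReal.rpow_mul]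
          rw [mul_div_cancel₀ _ ha0.ne']
        gcongr
    _ = C ^ ((p - q) / p) * (I ^ (q / p) * I ^ ((p - q) / p)) := by
        rw [ENNReal.mul_rpow_of_nonneg _ _ (by positivity)]
        ring
    _ = _ := by
        rw [← ENNReal.rpow_add_of_nonneg _ _ (by positivity) (by positivity),
          show q / p + (p - q) / p = 1 by field_simp; ring, ENNReal.rpow_one,
          ENNReal.coe_rpow_of_nonneg _ (by positivity)]

/-- Boundedness of the averages on the mixed norm space `L^q(L^p)` for `1 < q < p`. -/
theorem exists_mixedNorm_le_of_lt [IsFiniteMeasure μ] (hK : IsMaximalKernel K μ)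
    {ν : Measure Y} [SFinite ν] {p q : ℝ} (hq : 1 < q) (hqp : q < p) :
    ∃ C : ℝ≥0, ∀ g : Y → X → ℝ≥0∞, Measurable (Function.uncurry g) →
      ∫⁻ x, (∫⁻ y, (∫⁻ x', K y x x' * g y x' ∂μ) ^ p ∂ν) ^ (q / p) ∂μ ≤
        C * ∫⁻ x, (∫⁻ y, g y x ^ p ∂ν) ^ (q / p) ∂μ := by
  have hp0 : 0 < p := by linarith
  have hq0 : 0 < q := by linarith
  obtain ⟨C, hC⟩ := hK.exists_mixedNorm_le_majorant (ν := ν) hq hqp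
  -- `C + 1` is nonzero, so the bound is trivial when the right-hand integral is infinite.
  refine ⟨(C + 1) * (2 ^ (q - 1) * 2), fun g hg => ?_⟩
  have hG : Measurable fun x => ∫⁻ y, g y x ^ p ∂ν :=
    Measurable.lintegral_prod_left' (f := fun z : Y × X => g z.1 z.2 ^ p) (hg.pow_const p)
  set I := ∫⁻ x, (∫⁻ y, g y x ^ p ∂ν) ^ (q / p) ∂μ with hI
  have hIH : I = ∫⁻ x, ((∫⁻ y, g y x ^ p ∂ν) ^ (1 / p)) ^ q ∂μ := by
    rw [hI]
    refine lintegral_congr fun x => ?_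
    rw [← ENNReal.rpow_mul]
    congr 1
    ring
  by_cases hμ : μ univ = 0
  · rw [Measure.measure_univ_eq_zero.1 hμ]
    simp
  by_cases hIt : I = ∞
  · rw [hIt, ENNReal.mul_top]
    · exact le_top
    · have : ((C + 1) * (2 ^ (q - 1) * 2) : ℝ≥0) ≠ 0 := by positivity
      exact_mod_cast this
  -- the majorant `(∫ g^p)^{1/p} + c`
  have key : ∀ c : ℝ≥0∞, c ≠ 0 → c ≠ ∞ →
      ∫⁻ x, (∫⁻ y, (∫⁻ x', K y x x' * g y x' ∂μ) ^ p ∂ν) ^ (q / p) ∂μ ≤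
        C * (2 ^ (q - 1) * (I + c ^ q * μ univ)) := by
    intro c hc hc'
    refine (hC g hg (fun x => (∫⁻ y, g y x ^ p ∂ν) ^ (1 / p) + c) (by fun_prop) ?_ ?_).trans ?_
    · rw [hIH] at hIt
      filter_upwards [ae_lt_top (by fun_prop) hIt] with x hx
      refine ⟨by simp [hc], ENNReal.add_ne_top.2 ⟨?_, hc'⟩⟩
      exact ((ENNReal.rpow_lt_top_iff_of_pos hq0).1 hx).ne
    · intro x
      calc ∫⁻ y, g y x ^ p ∂ν = ((∫⁻ y, g y x ^ p ∂ν) ^ (1 / p)) ^ p := by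
            rw [← ENNReal.rpow_mul, one_div_mul_cancel hp0.ne', ENNReal.rpow_one]
        _ ≤ _ := ENNReal.rpow_le_rpow le_self_add hp0.le
    · refine mul_le_mul_right ?_ _
      calc ∫⁻ x, ((∫⁻ y, g y x ^ p ∂ν) ^ (1 / p) + c) ^ q ∂μ
          ≤ ∫⁻ x, 2 ^ (q - 1) * (((∫⁻ y, g y x ^ p ∂ν) ^ (1 / p)) ^ q + c ^ q) ∂μ :=
            lintegral_mono fun x => ENNReal.rpow_add_le_mul_rpow_add_rpow _ _ hq.le
        _ = 2 ^ (q - 1) * (I + c ^ q * μ univ) := by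
            rw [lintegral_const_mul _ (by fun_prop), lintegral_add_right _ measurable_const,
              ← hIH, lintegral_const]
  -- The shift `c` used below would vanish when `I = 0`. In that case `∫ g^p` is zero almost
  -- everywhere and the diagonal bound makes the averages vanish too.
  by_cases hI0 : I = 0
  · have h0 : ∀ᵐ x ∂μ, ∫⁻ y, g y x ^ p ∂ν = 0 := by
      rw [hI, lintegral_eq_zero_iff (by fun_prop)] at hI0
      filter_upwards [hI0] with x hx
      have hqp' : 0 < q / p := by positivity
      exact (ENNReal.rpow_eq_zero_iff_of_pos hqp').1 hx
    obtain ⟨D, hD⟩ := hK.exists_mixedNorm_le_of_le (ν := ν) (le_of_lt (hq.trans hqp)) le_rfl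
    have h1 := hD g hg
    simp only [div_self hp0.ne', ENNReal.rpow_one] at h1
    rw [lintegral_congr_ae h0] at h1
    simp only [lintegral_zero, mul_zero, nonpos_iff_eq_zero] at h1
    have hF : Measurable fun x => ∫⁻ y, (∫⁻ x', K y x x' * g y x' ∂μ) ^ p ∂ν :=
      Measurable.lintegral_prod_left' (f := fun z : Y × X =>
        (∫⁻ x', K z.1 z.2 x' * g z.1 x' ∂μ) ^ p) ((hK.measurable_lintegral_mul hg).pow_const p)
    rw [lintegral_eq_zero_iff hF] at h1
    rw [hI0, mul_zero, nonpos_iff_eq_zero, lintegral_eq_zero_iff (hF.pow_const _)]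
    filter_upwards [h1] with x hx
    have hqp' : 0 < q / p := by positivity
    exact (ENNReal.rpow_eq_zero_iff_of_pos hqp').2 hx
  · have hIμ : I / μ univ ≠ 0 := ENNReal.div_ne_zero.2 ⟨hI0, measure_ne_top μ _⟩
    have hIμ' : I / μ univ ≠ ∞ := ENNReal.div_ne_top hIt hμ
    -- This `c` is balanced so that `c ^ q * μ univ = I`.
    refine (key ((I / μ univ) ^ (1 / q)) (by simp [hIμ, hIμ']) (by simp [hIμ, hIμ'])).trans ?_
    rw [← ENNReal.rpow_mul, one_div_mul_cancel hq0.ne', ENNReal.rpow_one,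
      ENNReal.div_mul_cancel hμ (measure_ne_top μ _)]
    have : ((C + 1) * (2 ^ (q - 1) * 2) : ℝ≥0) * I = (C + 1) * (2 ^ (q - 1) * (I + I)) := by
      push_cast [ENNReal.coe_rpow_of_nonneg (2 : ℝ≥0) (show 0 ≤ q - 1 by linarith)]
      ring
    rw [this]
    gcongr
    exact le_self_add

end IsMaximalKernel

/-! ### Periodised maximal function and the Cauchy density. -/

open Real in
/-- The sum of the maximal functions of the translates of `w` by `-2π`, `0` and `2π`. -/
noncomputable def translatedMaximal (w : ℝ → ℝ≥0∞) (t : ℝ) : ℝ≥0∞ :=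
  maximalFunction w (t + 2 * π) + maximalFunction w t + maximalFunction w (t - 2 * π)

@[fun_prop]
theorem measurable_translatedMaximal (w : ℝ → ℝ≥0∞) : Measurable (translatedMaximal w) := by
  unfold translatedMaximal
  fun_prop

theorem exists_lintegral_translatedMaximal_rpow_le {s : ℝ} (hs : 1 < s) :
    ∃ C : ℝ≥0, ∀ w : ℝ → ℝ≥0∞, Measurable w →
      ∫⁻ x, translatedMaximal w x ^ s ≤ C * ∫⁻ x, w x ^ s := by
  obtain ⟨C, hC⟩ := exists_lintegral_maximalFunction_rpow_le hs
  refine ⟨2 ^ (s - 1) * (2 ^ (s - 1) * (C + C) + C), fun w hw => ?_⟩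
  set M := maximalFunction w with hM
  have hMm : Measurable M := measurable_maximalFunction w
  have h1 : ∫⁻ x, M (x + 2 * Real.pi) ^ s = ∫⁻ x, M x ^ s :=
    lintegral_add_right_eq_self (fun x => M x ^ s) _
  have h2 : ∫⁻ x, M (x - 2 * Real.pi) ^ s = ∫⁻ x, M x ^ s :=
    lintegral_sub_right_eq_self (fun x => M x ^ s) _
  calc ∫⁻ x, translatedMaximal w x ^ s
      ≤ ∫⁻ x, 2 ^ (s - 1) * (2 ^ (s - 1) * (M (x + 2 * Real.pi) ^ s + M x ^ s) +
          M (x - 2 * Real.pi) ^ s) := by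
        refine lintegral_mono fun x => ?_
        refine (ENNReal.rpow_add_le_mul_rpow_add_rpow _ _ hs.le).trans ?_
        gcongr
        exact ENNReal.rpow_add_le_mul_rpow_add_rpow _ _ hs.le
    _ = 2 ^ (s - 1) * (2 ^ (s - 1) * ((∫⁻ x, M x ^ s) + ∫⁻ x, M x ^ s) + ∫⁻ x, M x ^ s) := by
        rw [lintegral_const_mul _ (by fun_prop), lintegral_add_right _ (by fun_prop),
          lintegral_const_mul _ (by fun_prop), lintegral_add_right _ (by fun_prop), h1, h2]
    _ ≤ 2 ^ (s - 1) * (2 ^ (s - 1) * ((C * ∫⁻ x, w x ^ s) + C * ∫⁻ x, w x ^ s) +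
          C * ∫⁻ x, w x ^ s) := by
        gcongr <;> exact hC w hw
    _ = _ := by
        push_cast [ENNReal.coe_rpow_of_nonneg (2 : ℝ≥0) (show 0 ≤ s - 1 by linarith)]
        ring

/-- The Cauchy density is a superposition of normalized indicators of balls. -/
theorem ofReal_cauchy_le_tsum {a : ℝ} (ha : 0 < a) (v : ℝ) :
    ENNReal.ofReal (a / (a ^ 2 + v ^ 2)) ≤
      ∑' n : ℕ, (Metric.ball (0 : ℝ) (2 ^ n * a)).indicator
        (fun _ => ENNReal.ofReal (4 / (a * 4 ^ n))) v := by
  have hex : ∃ n : ℕ, |v| < 2 ^ n * a := by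
    obtain ⟨n, hn⟩ := pow_unbounded_of_one_lt (|v| / a) (one_lt_two)
    exact ⟨n, (div_lt_iff₀ ha).1 hn⟩
  classical
  -- Take the smallest dyadic ball containing `v`. If `n > 0`, minimality gives `v ^ 2 ≥ 4 ^ (n - 1)
  -- * a ^ 2`, whence the height `4 / (a * 4 ^ n)`.
  set n := Nat.find hex with hn
  have h1 : |v| < 2 ^ n * a := Nat.find_spec hex
  refine le_trans ?_ (ENNReal.le_tsum n)
  rw [indicator_of_mem (by simpa using h1)]
  refine ENNReal.ofReal_le_ofReal ?_
  rcases Nat.eq_zero_or_pos n with h0 | h0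
  · rw [h0, div_le_div_iff₀ (by positivity) (by positivity)]
    nlinarith [sq_nonneg v]
  · have h2 : ¬ |v| < 2 ^ (n - 1) * a := Nat.find_min hex (by omega)
    obtain ⟨m, hm⟩ : ∃ m, n = m + 1 := ⟨n - 1, by omega⟩
    rw [hm] at h2 ⊢
    simp only [Nat.add_sub_cancel, not_lt] at h2
    have h3 : (2 ^ m * a) ^ 2 ≤ v ^ 2 := by
      rw [← sq_abs v]
      exact pow_le_pow_left₀ (by positivity) h2 2
    have h4 : (2 ^ m * a) ^ 2 = 4 ^ m * a ^ 2 := by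
      rw [mul_pow, ← pow_mul, mul_comm m 2, pow_mul]; norm_num
    rw [div_le_div_iff₀ (by positivity) (by positivity), pow_succ]
    nlinarith [sq_nonneg a]

/-- The `n`-th indicator in the dyadic superposition has height times length `8 * 2⁻ⁿ`, and these
sum to 16. -/
theorem lintegral_cauchy_mul_le_maximalFunction {a : ℝ} (ha : 0 < a) {w : ℝ → ℝ≥0∞}
    (hw : Measurable w) (x : ℝ) :
    ∫⁻ y, ENNReal.ofReal (a / (a ^ 2 + (x - y) ^ 2)) * w y ≤ 16 * maximalFunction w x := by
  have hind : ∀ (n : ℕ) (y : ℝ), (Metric.ball (0 : ℝ) (2 ^ n * a)).indicator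
      (fun _ => ENNReal.ofReal (4 / (a * 4 ^ n))) (x - y) =
      (Metric.ball x (2 ^ n * a)).indicator (fun _ => ENNReal.ofReal (4 / (a * 4 ^ n))) y := by
    intro n y
    simp only [indicator, Metric.mem_ball, Real.dist_eq, sub_zero, abs_sub_comm x y]
  calc ∫⁻ y, ENNReal.ofReal (a / (a ^ 2 + (x - y) ^ 2)) * w y
      ≤ ∫⁻ y, ∑' n : ℕ, (Metric.ball x (2 ^ n * a)).indicator
          (fun y => ENNReal.ofReal (4 / (a * 4 ^ n)) * w y) y := by
        refine lintegral_mono fun y => ?_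
        refine (mul_le_mul_left (ofReal_cauchy_le_tsum ha (x - y)) _).trans (le_of_eq ?_)
        rw [← ENNReal.tsum_mul_right]
        refine tsum_congr fun n => ?_
        rw [hind, indicator_mul_left]
    _ = ∑' n : ℕ, ENNReal.ofReal (4 / (a * 4 ^ n)) * ∫⁻ y in Metric.ball x (2 ^ n * a), w y := by
        rw [lintegral_tsum fun n => (Measurable.indicator (by fun_prop)
          measurableSet_ball).aemeasurable]
        refine tsum_congr fun n => ?_
        rw [lintegral_indicator measurableSet_ball, lintegral_const_mul _ hw]
    _ ≤ ∑' n : ℕ, (8 * (2 : ℝ≥0∞)⁻¹ ^ n) * maximalFunction w x := by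
        refine ENNReal.tsum_le_tsum fun n => ?_
        have hb : x ∈ Metric.ball x (2 ^ n * a) := Metric.mem_ball_self (by positivity)
        refine (mul_le_mul_right (lintegral_ball_le_maximalFunction w hb) _).trans (le_of_eq ?_)
        rw [← mul_assoc, ← ENNReal.ofReal_mul (by positivity)]
        congr 1
        have : 4 / (a * 4 ^ n) * (2 * (2 ^ n * a)) = 8 * (2⁻¹ : ℝ) ^ n := by
          rw [show (4 : ℝ) = 2 * 2 by norm_num, mul_pow, inv_pow]
          field_simp
          norm_num
        rw [this, ENNReal.ofReal_mul (by norm_num), ENNReal.ofReal_pow (by norm_num),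
          ENNReal.ofReal_inv_of_pos (by norm_num)]
        norm_num
    _ = 16 * maximalFunction w x := by
        rw [ENNReal.tsum_mul_right, ENNReal.tsum_mul_left, ENNReal.tsum_geometric,
          ENNReal.one_sub_inv_two, inv_inv]
        norm_num

/-! ### Angles and distances in the disc. -/

/-- Comparison of angular and Euclidean distance in the disc. -/
theorem sq_angle_le {r ρ u : ℝ} (hr : 0 ≤ r) (hρ : |ρ - r| ≤ (1 - r) / 2) (hu : |u| ≤ Real.pi) :
    u ^ 2 ≤ 40 * (1 - r) ^ 2 + 20 * (ρ ^ 2 + r ^ 2 - 2 * ρ * r * Real.cos u) := by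
  have hpi := Real.pi_pos
  have hpi2 : Real.pi ^ 2 ≤ 10 := by nlinarith [Real.pi_lt_d2, Real.pi_gt_three]
  have hu2 : u ^ 2 ≤ Real.pi ^ 2 := sq_le_sq' (abs_le.1 hu).1 (abs_le.1 hu).2
  obtain ⟨h1, h2⟩ := abs_le.1 hρ
  have hD : ρ ^ 2 + r ^ 2 - 2 * ρ * r * Real.cos u =
      (ρ - r) ^ 2 + 4 * (ρ * r) * Real.sin (u / 2) ^ 2 := by
    have : Real.cos u = 1 - 2 * Real.sin (u / 2) ^ 2 := by
      rw [← Real.cos_sq_add_sin_sq (u / 2), show u = 2 * (u / 2) by ring, Real.cos_two_mul]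
      have := Real.cos_sq_add_sin_sq (u / 2)
      rw [show 2 * (u / 2) / 2 = u / 2 by ring]
      linarith
    rw [this]; ring
  -- For `r ≥ 1/2`, Jordan's inequality and `π² ≤ 10` give `u² ≤ 10 sin²(u/2)`, absorbed by the
  -- chord term since `ρ r ≥ 1/8`. For `r < 1/2`, `40 (1 - r)²` already exceeds `π²`.
  rcases le_or_gt (1 / 2) r with h | h
  · have hρ' : 1 / 4 ≤ ρ := by linarith
    have hs : 2 / Real.pi * |u / 2| ≤ |Real.sin (u / 2)| := by
      apply Real.mul_abs_le_abs_sin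
      rw [abs_div, abs_two]
      linarith
    have hs2 : u ^ 2 ≤ 10 * Real.sin (u / 2) ^ 2 := by
      have h3 : |u| ≤ Real.pi * |Real.sin (u / 2)| := by
        rw [abs_div, abs_two] at hs
        have : 2 / Real.pi * (|u| / 2) = |u| / Real.pi := by ring
        rw [this, div_le_iff₀ hpi] at hs
        linarith
      have h4 := pow_le_pow_left₀ (abs_nonneg u) h3 2
      rw [mul_pow, sq_abs, sq_abs] at h4
      exact h4.trans (mul_le_mul_of_nonneg_right hpi2 (sq_nonneg _))
    have h5 : 1 / 8 ≤ ρ * r := by nlinarith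
    rw [hD]
    nlinarith [sq_nonneg (1 - r), sq_nonneg (ρ - r), sq_nonneg (Real.sin (u / 2)),
      mul_le_mul_of_nonneg_right h5 (sq_nonneg (Real.sin (u / 2)))]
  · have h6 : 0 ≤ ρ ^ 2 + r ^ 2 - 2 * ρ * r * Real.cos u := by
      have := Real.sin_sq_add_cos_sq u
      nlinarith [sq_nonneg (ρ - r * Real.cos u), sq_nonneg (r * Real.sin u)]
    nlinarith

-- This is why `translatedMaximal` has three terms: an angle difference need only be shifted by
-- `-2π`, `0` or `2π` to land in `[-π, π]`. The range `3π` allows one angle in `[0, 2π)` and the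
-- other in either `[0, 2π)` or `(-π, π)`.
open Real in
theorem exists_abs_translate_le_pi {u : ℝ} (h1 : -(3 * π) ≤ u) (h2 : u ≤ 3 * π) :
    |u + 2 * π| ≤ π ∨ |u| ≤ π ∨ |u - 2 * π| ≤ π := by
  have := Real.pi_pos
  simp only [abs_le]
  by_cases h3 : u < -π
  · left; constructor <;> linarith
  · by_cases h4 : π < u
    · right; right; constructor <;> linarith
    · right; left; constructor <;> linarith

/-! ### Poisson kernel and Cauchy's formula for the derivative. -/

namespace AvgRadial

open Real

theorem polar_eq_circleMap (r t : ℝ) : polar r t = circleMap 0 r t := by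
  simp [polar, circleMap]

@[fun_prop]
theorem continuous_polar : Continuous fun z : ℝ × ℝ => polar z.1 z.2 := by
  unfold polar
  fun_prop

theorem norm_polar {r : ℝ} (hr : 0 ≤ r) (t : ℝ) : ‖polar r t‖ = r := by
  rw [polar_eq_circleMap, norm_circleMap_zero, abs_of_nonneg hr]

theorem norm_polar_sub_polar_sq (ρ r θ t : ℝ) :
    ‖polar ρ θ - polar r t‖ ^ 2 = ρ ^ 2 + r ^ 2 - 2 * ρ * r * cos (t - θ) := by
  rw [Complex.sq_norm, Complex.normSq_apply, cos_sub]
  simp only [polar, Complex.sub_re, Complex.sub_im, Complex.mul_re, Complex.mul_im,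
    Complex.ofReal_re, Complex.ofReal_im, Complex.exp_ofReal_mul_I_re,
    Complex.exp_ofReal_mul_I_im]
  linear_combination ρ ^ 2 * sin_sq_add_cos_sq θ + r ^ 2 * sin_sq_add_cos_sq t

/-- The Poisson kernel relating the circles of radii `(1 + r) / 2` and `r`. -/
noncomputable def radialPoisson (r u : ℝ) : ℝ :=
  (2 * π)⁻¹ * ((((1 + r) / 2) ^ 2 - r ^ 2) /
    (((1 + r) / 2) ^ 2 + r ^ 2 - 2 * ((1 + r) / 2) * r * cos u))

theorem radialPoisson_eq {r : ℝ} (hr : r ∈ Ico (0 : ℝ) 1) (t θ : ℝ) :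
    radialPoisson r (t - θ) =
      (2 * π)⁻¹ * poissonKernel 0 (polar r t) (polar ((1 + r) / 2) θ) := by
  have h0 := hr.1
  rw [radialPoisson, poissonKernel_def, sub_zero, sub_zero, norm_polar_sub_polar_sq,
    norm_polar hr.1, norm_polar (by linarith)]

theorem radialPoisson_nonneg {r : ℝ} (hr : r ∈ Ico (0 : ℝ) 1) (u : ℝ) :
    0 ≤ radialPoisson r u := by
  obtain ⟨h0, h1⟩ := hr
  unfold radialPoisson
  refine mul_nonneg (by positivity) (div_nonneg (by nlinarith) ?_)
  have := sin_sq_add_cos_sq u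
  nlinarith [sq_nonneg ((1 + r) / 2 - r * cos u), sq_nonneg (r * sin u)]

theorem radialPoisson_neg (r u : ℝ) : radialPoisson r (-u) = radialPoisson r u := by
  simp [radialPoisson]

/-- The denominator `D` is a squared distance, at least `((1 - r) / 2)²`; with `sq_angle_le` this
yields `(1 - r)² + v² ≤ 240 D`. The prefactor `(2π)⁻¹ ≤ 1/6` leaves 40. Only the cosine of `u`
matters, so `v` may be its translate in `[-π, π]`. -/
theorem radialPoisson_le {r : ℝ} (hr : r ∈ Ico (0 : ℝ) 1) {u v : ℝ} (hv : |v| ≤ π)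
    (huv : cos u = cos v) :
    radialPoisson r u ≤ 40 * ((1 - r) / ((1 - r) ^ 2 + v ^ 2)) := by
  obtain ⟨h0, h1⟩ := hr
  have h := sq_angle_le (r := r) (ρ := (1 + r) / 2) (u := v) h0
    (by rw [abs_of_nonneg (by linarith)]; linarith) hv
  unfold radialPoisson
  rw [huv]
  set D := ((1 + r) / 2) ^ 2 + r ^ 2 - 2 * ((1 + r) / 2) * r * cos v with hD
  have hDge : ((1 - r) / 2) ^ 2 ≤ D := by
    rw [hD]
    nlinarith [cos_le_one v, mul_nonneg (mul_nonneg (show (0:ℝ) ≤ (1 + r) / 2 by linarith) h0)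
      (sub_nonneg.2 (cos_le_one v))]
  have hDpos : 0 < D := lt_of_lt_of_le (by have := sub_pos.2 h1; positivity) hDge
  have hpi : (2 * π)⁻¹ ≤ 1 / 6 := by
    rw [one_div]
    exact inv_anti₀ (by norm_num) (by linarith [pi_gt_three])
  have hnum : ((1 + r) / 2) ^ 2 - r ^ 2 ≤ 1 - r := by nlinarith
  have hnum0 : 0 ≤ ((1 + r) / 2) ^ 2 - r ^ 2 := by nlinarith
  have hE : 0 < (1 - r) ^ 2 + v ^ 2 := by have := sub_pos.2 h1; positivity
  have hED : (1 - r) ^ 2 + v ^ 2 ≤ 240 * D := by nlinarith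
  calc (2 * π)⁻¹ * ((((1 + r) / 2) ^ 2 - r ^ 2) / D)
      ≤ 1 / 6 * ((1 - r) / D) := by
        refine mul_le_mul hpi ?_ (by positivity) (by norm_num)
        exact div_le_div_of_nonneg_right hnum hDpos.le
    _ ≤ 1 / 6 * (240 * ((1 - r) / ((1 - r) ^ 2 + v ^ 2))) := by
        refine mul_le_mul_of_nonneg_left ?_ (by norm_num)
        rw [← mul_div_assoc, div_le_div_iff₀ hDpos hE]
        nlinarith [sub_pos.2 h1]
    _ = _ := by ring

/-- Poisson's formula for the constant harmonic function 1. -/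
theorem lintegral_radialPoisson {r : ℝ} (hr : r ∈ Ico (0 : ℝ) 1) (t : ℝ) :
    ∫⁻ θ in Ico 0 (2 * π), ENNReal.ofReal (radialPoisson r (t - θ)) = 1 := by
  have h0 := hr.1
  have h1 := hr.2
  have hmem : polar r t ∈ Metric.ball (0 : ℂ) ((1 + r) / 2) := by
    rw [mem_ball_zero_iff, norm_polar hr.1]; linarith
  have hP := (InnerProductSpace.harmonicOnNhd_const (s := Metric.closedBall (0 : ℂ) ((1 + r) / 2))
    (1 : ℝ)).circleAverage_poissonKernel_smul hmem
  have hpos : ∀ u, 0 < ((1 + r) / 2) ^ 2 + r ^ 2 - 2 * ((1 + r) / 2) * r * cos u := by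
    intro u
    nlinarith [cos_le_one u, mul_nonneg (mul_nonneg (show (0:ℝ) ≤ (1 + r) / 2 by linarith) h0)
      (sub_nonneg.2 (cos_le_one u)), sq_pos_of_pos (sub_pos.2 h1)]
  have hcont : Continuous fun θ => radialPoisson r (t - θ) := by
    unfold radialPoisson
    exact continuous_const.mul (continuous_const.div (by fun_prop) fun θ => (hpos _).ne')
  have hint : ∫ θ in (0 : ℝ)..(2 * π), radialPoisson r (t - θ) = 1 := by
    rw [circleAverage_def] at hP
    rw [← hP, smul_eq_mul, ← intervalIntegral.integral_const_mul]
    refine intervalIntegral.integral_congr fun θ _ => ?_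
    simp [radialPoisson_eq hr, polar_eq_circleMap]
  rw [restrict_Ico_eq_restrict_Ioc, ← ofReal_integral_eq_lintegral_ofReal
    ((hcont.integrableOn_Icc (a := 0) (b := 2 * π)).mono_set Ioc_subset_Icc_self)
    (Filter.Eventually.of_forall fun θ => radialPoisson_nonneg hr _),
    ← intervalIntegral.integral_of_le (by positivity), hint, ENNReal.ofReal_one]

/-- The radial Poisson kernel on `[0, 1) × [0, 2π) × [0, 2π)`, extended by zero. -/
noncomputable def discKernel (r t θ : ℝ) : ℝ≥0∞ :=
  (Ico (0 : ℝ) 1 ×ˢ Ico 0 (2 * π) ×ˢ Ico 0 (2 * π)).indicator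
    (fun z : ℝ × ℝ × ℝ => ENNReal.ofReal (radialPoisson z.1 (z.2.1 - z.2.2))) (r, t, θ)

theorem discKernel_of_mem {r t θ : ℝ} (hr : r ∈ Ico (0 : ℝ) 1) (ht : t ∈ Ico 0 (2 * π))
    (hθ : θ ∈ Ico 0 (2 * π)) : discKernel r t θ = ENNReal.ofReal (radialPoisson r (t - θ)) :=
  indicator_of_mem (mk_mem_prod hr (mk_mem_prod ht hθ)) _

theorem discKernel_eq_zero {r t : ℝ} (h : ¬ (r ∈ Ico (0 : ℝ) 1 ∧ t ∈ Ico 0 (2 * π))) (θ : ℝ) :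
    discKernel r t θ = 0 :=
  indicator_of_notMem (fun hz => h ⟨hz.1, hz.2.1⟩) _

theorem discKernel_le {r t θ : ℝ} (hr : r ∈ Ico (0 : ℝ) 1) (ht : t ∈ Ico 0 (2 * π))
    (hθ : θ ∈ Ico 0 (2 * π)) : discKernel r t θ ≤
      40 * (ENNReal.ofReal ((1 - r) / ((1 - r) ^ 2 + (t + 2 * π - θ) ^ 2)) +
        ENNReal.ofReal ((1 - r) / ((1 - r) ^ 2 + (t - θ) ^ 2)) +
        ENNReal.ofReal ((1 - r) / ((1 - r) ^ 2 + (t - 2 * π - θ) ^ 2))) := by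
  have hpi := pi_pos
  rw [discKernel_of_mem hr ht hθ]
  have key : ∀ v, |v| ≤ π → cos (t - θ) = cos v →
      ENNReal.ofReal (radialPoisson r (t - θ)) ≤
        40 * ENNReal.ofReal ((1 - r) / ((1 - r) ^ 2 + v ^ 2)) := by
    intro v hv huv
    refine (ENNReal.ofReal_le_ofReal (radialPoisson_le hr hv huv)).trans (le_of_eq ?_)
    rw [ENNReal.ofReal_mul (by norm_num)]
    norm_num
  rcases exists_abs_translate_le_pi (u := t - θ) (by linarith [ht.1, hθ.2])
    (by linarith [ht.2, hθ.1]) with h | h | h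
  · refine (key _ h (cos_add_two_pi _).symm).trans (mul_le_mul_right ?_ _)
    rw [show t + 2 * π - θ = t - θ + 2 * π by ring]
    exact le_self_add.trans le_self_add
  · refine (key _ h rfl).trans (mul_le_mul_right ?_ _)
    exact le_add_self.trans le_self_add
  · refine (key _ h (cos_sub_two_pi _).symm).trans (mul_le_mul_right ?_ _)
    rw [show t - 2 * π - θ = t - θ - 2 * π by ring]
    exact le_add_self

theorem isMaximalKernel_discKernel :
    IsMaximalKernel discKernel (volume.restrict (Ico 0 (2 * π))) where
  measurable := by
    have h : Measurable fun z : ℝ × ℝ × ℝ =>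
        ENNReal.ofReal (radialPoisson z.1 (z.2.1 - z.2.2)) := by
      unfold radialPoisson
      fun_prop
    exact (h.indicator (measurableSet_Ico.prod (measurableSet_Ico.prod measurableSet_Ico))).comp
      (f := fun z : (ℝ × ℝ) × ℝ => (z.1.1, z.1.2, z.2)) (by fun_prop)
  symm r t θ := by
    by_cases h : r ∈ Ico (0 : ℝ) 1 ∧ t ∈ Ico 0 (2 * π) ∧ θ ∈ Ico 0 (2 * π)
    · rw [discKernel_of_mem h.1 h.2.1 h.2.2, discKernel_of_mem h.1 h.2.2 h.2.1,
        ← radialPoisson_neg, neg_sub]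
    · rw [discKernel, discKernel, indicator_of_notMem, indicator_of_notMem]
      · exact fun hz => h ⟨hz.1, hz.2.2, hz.2.1⟩
      · exact fun hz => h ⟨hz.1, hz.2.1, hz.2.2⟩
  mass_le_one r t := by
    by_cases h : r ∈ Ico (0 : ℝ) 1 ∧ t ∈ Ico 0 (2 * π)
    · rw [← lintegral_radialPoisson h.1 t]
      exact (setLIntegral_congr_fun measurableSet_Ico fun θ hθ =>
        discKernel_of_mem h.1 h.2 hθ).le
    · simp [discKernel_eq_zero h]
  maximal s hs := by
    obtain ⟨C, hC⟩ := exists_lintegral_translatedMaximal_rpow_le hs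
    refine ⟨640 ^ s * C, fun w hw => ?_⟩
    set W := (Ico 0 (2 * π)).indicator w with hW
    have hWm : Measurable W := hw.indicator measurableSet_Ico
    -- `640 = 40 * 16`: the comparison with three Cauchy densities, then the maximal bound for each
    -- of them.
    refine ⟨fun t => 640 * translatedMaximal W t, by fun_prop, fun r t => ?_, ?_⟩
    · by_cases h : r ∈ Ico (0 : ℝ) 1 ∧ t ∈ Ico 0 (2 * π)
      swap
      · simp [discKernel_eq_zero h]
      have ha : 0 < 1 - r := sub_pos.2 h.1.2
      set k : ℝ → ℝ → ℝ≥0∞ := fun x θ =>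
        ENNReal.ofReal ((1 - r) / ((1 - r) ^ 2 + (x - θ) ^ 2)) with hk
      have hkm : ∀ x, Measurable fun θ => k x θ * W θ := fun x => by
        refine Measurable.mul ?_ hWm
        simp only [hk]
        fun_prop
      have hkM : ∀ x, ∫⁻ θ, k x θ * W θ ≤ 16 * maximalFunction W x :=
        lintegral_cauchy_mul_le_maximalFunction ha hWm
      calc ∫⁻ θ in Ico 0 (2 * π), discKernel r t θ * w θ
          ≤ ∫⁻ θ in Ico 0 (2 * π), 40 * (k (t + 2 * π) θ * W θ + k t θ * W θ +
              k (t - 2 * π) θ * W θ) := by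
            refine setLIntegral_mono' measurableSet_Ico fun θ hθ => ?_
            rw [hW, indicator_of_mem hθ, ← add_mul, ← add_mul, ← mul_assoc]
            exact mul_le_mul_left (discKernel_le h.1 h.2 hθ) _
        _ ≤ ∫⁻ θ, 40 * (k (t + 2 * π) θ * W θ + k t θ * W θ + k (t - 2 * π) θ * W θ) :=
            setLIntegral_le_lintegral _ _
        _ = 40 * ((∫⁻ θ, k (t + 2 * π) θ * W θ) + (∫⁻ θ, k t θ * W θ) +
              ∫⁻ θ, k (t - 2 * π) θ * W θ) := by
            rw [lintegral_const_mul' _ _ (by simp),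
              lintegral_add_right _ (hkm _), lintegral_add_right _ (hkm _)]
        _ ≤ 40 * (16 * maximalFunction W (t + 2 * π) + 16 * maximalFunction W t +
              16 * maximalFunction W (t - 2 * π)) := by
            gcongr <;> exact hkM _
        _ = 640 * translatedMaximal W t := by
            rw [translatedMaximal]; ring
    · have hs0 : 0 ≤ s := by linarith
      calc ∫⁻ t in Ico 0 (2 * π), (640 * translatedMaximal W t) ^ s
          ≤ ∫⁻ t, (640 * translatedMaximal W t) ^ s := setLIntegral_le_lintegral _ _
        _ = 640 ^ s * ∫⁻ t, translatedMaximal W t ^ s := by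
            rw [← lintegral_const_mul _ (by fun_prop)]
            refine lintegral_congr fun t => ENNReal.mul_rpow_of_nonneg _ _ hs0
        _ ≤ 640 ^ s * (C * ∫⁻ t, W t ^ s) := mul_le_mul_right (hC W hWm) _
        _ = _ := by
            have : ∫⁻ t, W t ^ s = ∫⁻ t in Ico 0 (2 * π), w t ^ s := by
              rw [← lintegral_indicator measurableSet_Ico]
              refine lintegral_congr fun t => ?_
              by_cases ht : t ∈ Ico 0 (2 * π)
              · simp [hW, ht]
              · rw [hW, indicator_of_notMem ht, indicator_of_notMem ht,
                  ENNReal.zero_rpow_of_pos (by linarith)]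
            rw [this]
            push_cast [ENNReal.coe_rpow_of_nonneg (640 : ℝ≥0) hs0]
            ring

/-- The Cauchy formula bounds the weighted derivative by Poisson averages. -/
theorem enorm_deriv_mul_le_lintegral {f : ℂ → ℂ} (hf : DifferentiableOn ℂ f (Metric.ball 0 1))
    {r t : ℝ} (hr : r ∈ Ico (0 : ℝ) 1) (ht : t ∈ Ico 0 (2 * π)) :
    ‖deriv f (polar r t) * ((1 - ‖polar r t‖ : ℝ) : ℂ)‖ₑ ≤
      2 * ∫⁻ θ in Ico 0 (2 * π), discKernel r t θ * ‖f (polar ((1 + r) / 2) θ)‖ₑ := by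
  have h0 := hr.1
  have h1 := hr.2
  have hmem : polar r t ∈ Metric.ball (0 : ℂ) ((1 + r) / 2) := by
    rw [mem_ball_zero_iff, norm_polar hr.1]; linarith
  have hsub : Metric.closedBall (0 : ℂ) ((1 + r) / 2) ⊆ Metric.ball 0 1 :=
    Metric.closedBall_subset_ball (by linarith)
  have hC := Complex.two_pi_I_inv_smul_circleIntegral_sub_sq_inv_smul_of_differentiable
    Metric.isOpen_ball hsub hf hmem
  rw [← hC, norm_polar h0, circleIntegral, intervalIntegral.integral_of_le (by positivity),
    ← restrict_Ico_eq_restrict_Ioc, smul_eq_mul, mul_right_comm, enorm_mul,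
    ← lintegral_const_mul' _ _ (by simp)]
  refine (mul_le_mul_right (enorm_integral_le_lintegral_enorm _) _).trans ?_
  rw [← lintegral_const_mul' _ _ enorm_ne_top]
  refine setLIntegral_mono' measurableSet_Ico fun θ hθ => ?_
  rw [smul_smul, smul_eq_mul, enorm_mul (_ * _) (f _), ← mul_assoc, ← mul_assoc, polar_eq_circleMap _ θ]
  refine mul_le_mul_left ?_ _
  rw [discKernel_of_mem hr ht hθ, ← enorm_mul, ← ofReal_norm,
    show (2 : ℝ≥0∞) = ENNReal.ofReal 2 by norm_num, ← ENNReal.ofReal_mul (by norm_num)]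
  refine ENNReal.ofReal_le_ofReal ?_
  rw [radialPoisson, ← norm_polar_sub_polar_sq, ← polar_eq_circleMap]
  have hn : ‖deriv (circleMap 0 ((1 + r) / 2)) θ‖ = (1 + r) / 2 := by
    simp only [deriv_circleMap, norm_mul, norm_circleMap_zero, Complex.norm_I, mul_one]
    exact abs_of_nonneg (by linarith)
  have h2 : ‖(2 * π * Complex.I : ℂ)⁻¹‖ = (2 * π)⁻¹ := by
    simp [abs_of_nonneg pi_pos.le]
  have h3 : ‖((1 - r : ℝ) : ℂ)‖ = 1 - r := by
    rw [Complex.norm_real, norm_of_nonneg (by linarith)]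
  rw [norm_mul, norm_mul, norm_mul, hn, h2, h3, norm_inv, norm_pow]
  -- The right side equals `(1 - r)(1 + 3r) / 2`; here the weight `1 - r` produces the numerator of
  -- the Poisson kernel.
  have h4 : (1 - r) * ((1 + r) / 2) ≤ 2 * (((1 + r) / 2) ^ 2 - r ^ 2) := by nlinarith
  calc (2 * π)⁻¹ * (1 - r) * ((1 + r) / 2 * (‖polar ((1 + r) / 2) θ - polar r t‖ ^ 2)⁻¹)
      = (2 * π)⁻¹ * (((1 - r) * ((1 + r) / 2)) / ‖polar ((1 + r) / 2) θ - polar r t‖ ^ 2) := by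
        ring
    _ ≤ (2 * π)⁻¹ * ((2 * (((1 + r) / 2) ^ 2 - r ^ 2)) /
          ‖polar ((1 + r) / 2) θ - polar r t‖ ^ 2) := by gcongr
    _ = _ := by ring

end AvgRadial

/-! ### Mean value inequalities and the radial maximal function. -/

theorem ContinuousOn.measurable_indicator {α β : Type*} [TopologicalSpace α] [MeasurableSpace α]
    [OpensMeasurableSpace α] [TopologicalSpace β] [MeasurableSpace β] [BorelSpace β] [Zero β]
    {f : α → β} {s : Set α} (hf : ContinuousOn f s) (hs : MeasurableSet s) :
    Measurable (s.indicator f) := by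
  classical
  rw [← piecewise_eq_indicator]
  exact hf.measurable_piecewise continuousOn_const hs

namespace AvgRadial

open Real

theorem lintegral_eq_lintegral_polar {F : ℂ → ℝ≥0∞} (hF : Measurable F) :
    ∫⁻ z, F z = ∫⁻ ρ in Ioi (0 : ℝ), ∫⁻ θ in Ioo (-π) π, ENNReal.ofReal ρ * F (polar ρ θ) := by
  have hm : Measurable fun p : ℝ × ℝ => ENNReal.ofReal p.1 * F (polar p.1 p.2) :=
    (by fun_prop : Measurable fun p : ℝ × ℝ => ENNReal.ofReal p.1).mul
      (hF.comp continuous_polar.measurable)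
  rw [← Complex.lintegral_comp_polarCoord_symm, polarCoord_target, Measure.volume_eq_prod,
    ← Measure.prod_restrict, ← lintegral_prod _ hm.aemeasurable]
  refine lintegral_congr fun p => ?_
  rw [smul_eq_mul, Complex.polarCoord_symm_apply, polar, Complex.exp_mul_I]
  simp

/-- The mean value inequality over a disc. -/
theorem enorm_mul_ofReal_sq_le_lintegral {f : ℂ → ℂ} {c : ℂ} {η : ℝ} (hη : 0 < η)
    (hf : DifferentiableOn ℂ f (Metric.ball c η)) :
    ‖f c‖ₑ * ENNReal.ofReal (η ^ 2) ≤ ∫⁻ z in Metric.ball c η, ‖f z‖ₑ := by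
  set F : ℂ → ℝ≥0∞ := fun z => (Metric.ball 0 η).indicator (fun z => ‖f (c + z)‖ₑ) z with hF
  have hcont : ContinuousOn (fun z => ‖f (c + z)‖ₑ) (Metric.ball 0 η) := by
    refine continuous_enorm.comp_continuousOn (hf.continuousOn.comp (by fun_prop) fun z hz => ?_)
    simpa using hz
  have hFm : Measurable F := hcont.measurable_indicator measurableSet_ball
  have h1 : ∫⁻ z in Metric.ball c η, ‖f z‖ₑ = ∫⁻ z, F z := by
    rw [← lintegral_indicator measurableSet_ball, ← lintegral_add_left_eq_self _ c]
    refine lintegral_congr fun z => ?_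
    by_cases hz : z ∈ Metric.ball 0 η
    · have : c + z ∈ Metric.ball c η := by simpa using hz
      simp [hF, hz, this]
    · have : c + z ∉ Metric.ball c η := by simpa using hz
      simp only [hF, indicator_of_notMem hz, indicator_of_notMem this]
  rw [h1, lintegral_eq_lintegral_polar hFm]
  have hcirc : ∀ ρ ∈ Ioo 0 η, ENNReal.ofReal (2 * π) * ‖f c‖ₑ ≤
      ∫⁻ θ in Ioo (-π) π, ‖f (c + polar ρ θ)‖ₑ := by
    intro ρ hρ
    have hsub : Metric.closedBall c ρ ⊆ Metric.ball c η := Metric.closedBall_subset_ball hρ.2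
    have hd : DiffContOnCl ℂ f (Metric.ball c |ρ|) := by
      rw [abs_of_pos hρ.1]
      exact hf.diffContOnCl_ball hsub
    have hav := hd.circleAverage
    rw [circleAverage_eq_integral_add (-π), intervalIntegral.integral_comp_add_right
      (fun θ => f (circleMap c ρ θ)), show 0 + -π = -π by ring, show 2 * π + -π = π by ring,
      intervalIntegral.integral_of_le (by linarith [pi_pos]), integral_Ioc_eq_integral_Ioo] at hav
    have hav' : ∫ θ in Ioo (-π) π, f (circleMap c ρ θ) = (2 * π) • f c := by
      rw [← hav, smul_smul, mul_inv_cancel₀ (by positivity), one_smul]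
    have := enorm_integral_le_lintegral_enorm (μ := volume.restrict (Ioo (-π) π))
      (fun θ => f (circleMap c ρ θ))
    rw [hav', enorm_smul, Real.enorm_of_nonneg (by positivity)] at this
    refine this.trans (le_of_eq (lintegral_congr fun θ => ?_))
    simp [polar, circleMap]
  -- Radii in `(η/2, η)` suffice: there `2πρ ≥ 2η`, and the interval has length `η/2`.
  calc ‖f c‖ₑ * ENNReal.ofReal (η ^ 2)
      ≤ ∫⁻ ρ in Ioo (η / 2) η, ‖f c‖ₑ * ENNReal.ofReal (2 * η) := by
        rw [setLIntegral_const, Real.volume_Ioo, mul_assoc, ← ENNReal.ofReal_mul (by positivity)]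
        refine mul_le_mul_right (ENNReal.ofReal_le_ofReal (le_of_eq (by ring))) _
    _ ≤ ∫⁻ ρ in Ioo (η / 2) η, ∫⁻ θ in Ioo (-π) π, ENNReal.ofReal ρ * F (polar ρ θ) := by
        refine setLIntegral_mono' measurableSet_Ioo fun ρ hρ => ?_
        have hρ0 : 0 < ρ := lt_trans (by positivity) hρ.1
        rw [lintegral_const_mul' _ _ (by simp)]
        calc ‖f c‖ₑ * ENNReal.ofReal (2 * η)
            ≤ ENNReal.ofReal ρ * (ENNReal.ofReal (2 * π) * ‖f c‖ₑ) := by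
              rw [mul_comm, ← mul_assoc, ← ENNReal.ofReal_mul hρ0.le]
              refine mul_le_mul_left (ENNReal.ofReal_le_ofReal ?_) _
              have := hρ.1
              nlinarith [pi_gt_three]
          _ ≤ ENNReal.ofReal ρ * ∫⁻ θ in Ioo (-π) π, ‖f (c + polar ρ θ)‖ₑ :=
              mul_le_mul_right (hcirc ρ ⟨hρ0, hρ.2⟩) _
          _ = ENNReal.ofReal ρ * ∫⁻ θ in Ioo (-π) π, F (polar ρ θ) := by
              congr 1
              refine lintegral_congr fun θ => ?_
              rw [hF]
              simp only
              rw [indicator_of_mem]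
              rw [mem_ball_zero_iff, norm_polar hρ0.le]
              exact hρ.2
    _ ≤ ∫⁻ ρ in Ioi (0 : ℝ), ∫⁻ θ in Ioo (-π) π, ENNReal.ofReal ρ * F (polar ρ θ) :=
        lintegral_mono_set fun ρ hρ => lt_trans (by positivity) hρ.1

/-- The mean value inequality over a disc for the square root of the modulus of a holomorphic
function. -/
theorem enorm_rpow_half_mul_le_lintegral {f : ℂ → ℂ} {c : ℂ} {δ : ℝ} (hδ : 0 < δ)
    (hf : DifferentiableOn ℂ f (Metric.ball c δ))
    (hcont : ContinuousOn f (Metric.closedBall c δ)) :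
    ‖f c‖ₑ ^ (1 / 2 : ℝ) * ENNReal.ofReal (δ ^ 2) ≤
      16 * ∫⁻ z in Metric.ball c δ, ‖f z‖ₑ ^ (1 / 2 : ℝ) := by
  set g : ℂ → ℝ≥0∞ := fun z => ‖f z‖ₑ ^ (1 / 2 : ℝ) with hg
  have hgg : ∀ z, g z * g z = ‖f z‖ₑ := by
    intro z
    rw [hg, ← ENNReal.rpow_add_of_nonneg _ _ (by norm_num) (by norm_num)]
    norm_num
  set I := ∫⁻ z in Metric.ball c δ, g z with hI
  set d : ℂ → ℝ := fun z => δ - dist z c with hd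
  -- the weighted supremum
  set σ := ⨆ z ∈ Metric.ball c δ, g z * ENNReal.ofReal (d z ^ 2) with hσ
  -- Continuity up to the boundary makes `σ` finite, so it can be cancelled in `σ² ≤ 16 σ I`.
  have hσtop : σ ≠ ∞ := by
    obtain ⟨M, hM⟩ := (isCompact_closedBall c δ).exists_bound_of_continuousOn hcont
    refine ne_top_of_le_ne_top (b := ENNReal.ofReal M ^ (1 / 2 : ℝ) * ENNReal.ofReal (δ ^ 2)) ?_ ?_
    · exact ENNReal.mul_ne_top (ENNReal.rpow_ne_top_of_nonneg (by norm_num) ENNReal.ofReal_ne_top)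
        ENNReal.ofReal_ne_top
    · refine iSup₂_le fun z hz => ?_
      have hz' : dist z c < δ := hz
      refine mul_le_mul' (ENNReal.rpow_le_rpow ?_ (by norm_num)) (ENNReal.ofReal_le_ofReal ?_)
      · rw [← ofReal_norm]
        exact ENNReal.ofReal_le_ofReal (hM z (Metric.ball_subset_closedBall hz))
      · have : 0 ≤ dist z c := dist_nonneg
        simp only [hd]
        nlinarith
  -- On the ball of radius `d w / 2` about `w` one has `d v ≥ d w / 2`, so one of the two factors `g
  -- v` in `‖f v‖` is bounded through `σ`. The mean value inequality for `f` itself then leaves an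
  -- integral of `g`.
  have key : ∀ w ∈ Metric.ball c δ, g w * ENNReal.ofReal (d w ^ 2) ≤ (16 * σ * I) ^ (1 / 2 : ℝ) := by
    intro w hw
    have hdw : 0 < d w := sub_pos.2 hw
    have hball : Metric.ball w (d w / 2) ⊆ Metric.ball c δ :=
      Metric.ball_subset_ball' (by simp only [hd]; linarith [show dist w c < δ from hw])
    have hv : ∀ v ∈ Metric.ball w (d w / 2),
        ENNReal.ofReal (d w ^ 2) * ‖f v‖ₑ ≤ 4 * σ * g v := by
      intro v hv
      have hvd : d w / 2 ≤ d v := by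
        have h1 : dist v w < d w / 2 := hv
        have h2 := dist_triangle v w c
        simp only [hd] at h1 ⊢
        linarith
      have h3 : g v * ENNReal.ofReal (d v ^ 2) ≤ σ :=
        le_iSup₂ (f := fun z (_ : z ∈ Metric.ball c δ) => g z * ENNReal.ofReal (d z ^ 2)) v
          (hball hv)
      calc ENNReal.ofReal (d w ^ 2) * ‖f v‖ₑ
          ≤ ENNReal.ofReal (4 * d v ^ 2) * (g v * g v) := by
            rw [hgg]
            refine mul_le_mul_left (ENNReal.ofReal_le_ofReal ?_) _
            nlinarith
        _ = 4 * (g v * ENNReal.ofReal (d v ^ 2)) * g v := by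
            rw [ENNReal.ofReal_mul (by norm_num), show ENNReal.ofReal 4 = 4 by norm_num]
            ring
        _ ≤ 4 * σ * g v := by gcongr
    have hmean := enorm_mul_ofReal_sq_le_lintegral (half_pos hdw) (hf.mono hball)
    have hsq : (g w * ENNReal.ofReal (d w ^ 2)) * (g w * ENNReal.ofReal (d w ^ 2)) ≤
        16 * σ * I := by
      calc (g w * ENNReal.ofReal (d w ^ 2)) * (g w * ENNReal.ofReal (d w ^ 2))
          = 4 * (ENNReal.ofReal (d w ^ 2) * (‖f w‖ₑ * ENNReal.ofReal ((d w / 2) ^ 2))) := by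
            have : ENNReal.ofReal (d w ^ 2) = 4 * ENNReal.ofReal ((d w / 2) ^ 2) := by
              rw [show (4 : ℝ≥0∞) = ENNReal.ofReal 4 by norm_num,
                ← ENNReal.ofReal_mul (by norm_num)]
              congr 1; ring
            rw [← hgg w, this]
            ring
        _ ≤ 4 * (ENNReal.ofReal (d w ^ 2) * ∫⁻ z in Metric.ball w (d w / 2), ‖f z‖ₑ) := by gcongr
        _ = 4 * ∫⁻ z in Metric.ball w (d w / 2), ENNReal.ofReal (d w ^ 2) * ‖f z‖ₑ := by
            rw [lintegral_const_mul' _ _ ENNReal.ofReal_ne_top]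
        _ ≤ 4 * ∫⁻ z in Metric.ball w (d w / 2), 4 * σ * g z :=
            mul_le_mul_right (setLIntegral_mono' measurableSet_ball hv) _
        _ = 16 * σ * ∫⁻ z in Metric.ball w (d w / 2), g z := by
            rw [lintegral_const_mul' _ _ (ENNReal.mul_ne_top (by simp) hσtop)]
            ring
        _ ≤ 16 * σ * I := mul_le_mul_right (lintegral_mono_set hball) _
    calc g w * ENNReal.ofReal (d w ^ 2)
        = ((g w * ENNReal.ofReal (d w ^ 2)) * (g w * ENNReal.ofReal (d w ^ 2))) ^ (1 / 2 : ℝ) := by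
          rw [← sq, ← ENNReal.rpow_natCast, ← ENNReal.rpow_mul]
          norm_num
      _ ≤ _ := ENNReal.rpow_le_rpow hsq (by norm_num)
  have hσsq : σ * σ ≤ 16 * σ * I := by
    have h1 : σ ≤ (16 * σ * I) ^ (1 / 2 : ℝ) := iSup₂_le key
    calc σ * σ ≤ (16 * σ * I) ^ (1 / 2 : ℝ) * (16 * σ * I) ^ (1 / 2 : ℝ) := mul_le_mul' h1 h1
      _ = 16 * σ * I := by
          rw [← ENNReal.rpow_add_of_nonneg _ _ (by norm_num) (by norm_num)]
          norm_num
  have hσI : σ ≤ 16 * I := by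
    by_cases h0 : σ = 0
    · rw [h0]; exact zero_le
    · rw [mul_comm 16 σ, mul_assoc] at hσsq
      exact (ENNReal.mul_le_mul_iff_right h0 hσtop).1 hσsq
  refine le_trans ?_ hσI
  have := le_iSup₂ (f := fun z (_ : z ∈ Metric.ball c δ) => g z * ENNReal.ofReal (d z ^ 2)) c
    (Metric.mem_ball_self hδ)
  simpa only [hd, dist_self, sub_zero] using this

/-- The radial maximal function. -/
noncomputable def radialSup (f : ℂ → ℂ) (t : ℝ) : ℝ≥0∞ := ⨆ r ∈ Ico (0 : ℝ) 1, ‖f (polar r t)‖ₑ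

theorem measurable_radialSup {f : ℂ → ℂ} (hf : ContinuousOn f (Metric.ball 0 1)) :
    Measurable (radialSup f) := by
  refine LowerSemicontinuous.measurable (lowerSemicontinuous_biSup fun r hr => ?_)
  refine Continuous.lowerSemicontinuous (continuous_enorm.comp ?_)
  refine hf.comp_continuous (continuous_polar.comp (f := fun t => (r, t)) (by fun_prop))
    fun t => ?_
  rw [mem_ball_zero_iff]
  exact (norm_polar hr.1 t).trans_lt hr.2

theorem radialSup_periodic (f : ℂ → ℂ) : Function.Periodic (radialSup f) (2 * π) := by
  intro t
  simp only [radialSup, polar_eq_circleMap, periodic_circleMap 0 _ t]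

theorem lintegral_Ioo_eq_lintegral_Ico_of_periodic {F : ℝ → ℝ≥0∞}
    (hF : Function.Periodic F (2 * π)) :
    ∫⁻ t in Ioo (-π) π, F t = ∫⁻ t in Ico 0 (2 * π), F t := by
  have h2 : (0 : ℝ) < 2 * π := by positivity
  have h := (isAddFundamentalDomain_Ioc h2 (-π)).setLIntegral_eq (isAddFundamentalDomain_Ioc h2 0)
    F (by
      rintro ⟨g, hg⟩ x
      obtain ⟨n, rfl⟩ := AddSubgroup.mem_zmultiples_iff.1 hg
      rw [AddSubgroup.vadd_def, vadd_eq_add, add_comm]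
      exact (hF.zsmul n) x)
  rw [show -π + 2 * π = π by ring, zero_add] at h
  rw [restrict_Ioo_eq_restrict_Ioc, restrict_Ico_eq_restrict_Ioc, h]

/-- Integrals over small discs are dominated by the maximal function of the radial supremum. -/
theorem lintegral_ball_rpow_half_le {f : ℂ → ℂ} (hf : ContinuousOn f (Metric.ball 0 1))
    {r t : ℝ} (hr : r ∈ Ico (0 : ℝ) 1) (ht : t ∈ Ico 0 (2 * π)) :
    ∫⁻ z in Metric.ball (polar r t) ((1 - r) / 2), ‖f z‖ₑ ^ (1 / 2 : ℝ) ≤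
      ENNReal.ofReal (14 * (1 - r) ^ 2) * translatedMaximal
        ((Ioo (-π) π).indicator fun θ => radialSup f θ ^ (1 / 2 : ℝ)) t := by
  have h0 := hr.1
  have h1 := hr.2
  have hpi := pi_pos
  set δ := 1 - r with hδ
  have hδ0 : 0 < δ := by linarith
  set D := Metric.ball (polar r t) (δ / 2) with hD
  have hDsub : D ⊆ Metric.ball 0 1 := Metric.ball_subset_ball' (by
    rw [dist_zero_right, norm_polar h0]; linarith)
  set B : ℝ → ℝ≥0∞ := fun θ => radialSup f θ ^ (1 / 2 : ℝ) with hB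
  have hBm : Measurable B := (measurable_radialSup hf).pow_const _
  set W := (Ioo (-π) π).indicator B with hW
  have hWm : Measurable W := hBm.indicator measurableSet_Ioo
  set F : ℂ → ℝ≥0∞ := D.indicator fun z => ‖f z‖ₑ ^ (1 / 2 : ℝ) with hF
  have hFm : Measurable F := by
    have hc : ContinuousOn (fun z => ‖f z‖ₑ ^ (1 / 2 : ℝ)) D :=
      ENNReal.continuous_rpow_const.comp_continuousOn
        (continuous_enorm.comp_continuousOn (hf.mono hDsub))
    exact hc.measurable_indicator measurableSet_ball
  set χ : ℝ → ℝ → ℝ≥0∞ := fun x θ => (Metric.ball x (7 * δ)).indicator W θ with hχ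
  have hχm : ∀ x, Measurable (χ x) := fun x => hWm.indicator measurableSet_ball
  have hpt : ∀ ρ ∈ Ioi (0 : ℝ), ∀ θ ∈ Ioo (-π) π, ENNReal.ofReal ρ * F (polar ρ θ) ≤
      (Metric.ball r (δ / 2)).indicator
        (fun _ => χ (t + 2 * π) θ + χ t θ + χ (t - 2 * π) θ) ρ := by
    intro ρ hρ θ hθ
    have hρ0 : 0 < ρ := hρ
    by_cases hmem : polar ρ θ ∈ D
    swap
    · simp [hF, hmem]
    have hmem' : ‖polar ρ θ - polar r t‖ < δ / 2 := by
      simpa [hD, dist_eq_norm] using hmem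
    have hρr : |ρ - r| < δ / 2 := by
      refine lt_of_le_of_lt ?_ hmem'
      have := abs_norm_sub_norm_le (polar ρ θ) (polar r t)
      rwa [norm_polar hρ0.le, norm_polar h0] at this
    have hρ1 : ρ < 1 := by linarith [(abs_lt.1 hρr).2]
    rw [indicator_of_mem (by simpa [Real.dist_eq] using hρr)]
    have hFle : ENNReal.ofReal ρ * F (polar ρ θ) ≤ W θ := by
      have h2 : ‖f (polar ρ θ)‖ₑ ≤ radialSup f θ :=
        le_iSup₂ (f := fun r (_ : r ∈ Ico (0 : ℝ) 1) => ‖f (polar r θ)‖ₑ) ρ ⟨hρ0.le, hρ1⟩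
      calc ENNReal.ofReal ρ * F (polar ρ θ) ≤ 1 * F (polar ρ θ) := by
            refine mul_le_mul_left ?_ _
            rw [← ENNReal.ofReal_one]
            exact ENNReal.ofReal_le_ofReal hρ1.le
        _ ≤ W θ := by
            rw [one_mul, hF, indicator_of_mem hmem, hW, indicator_of_mem hθ]
            exact ENNReal.rpow_le_rpow h2 (by norm_num)
    refine hFle.trans ?_
    -- `sq_angle_le` gives `v² ≤ (40 + 20/4) δ² < (7δ)²`.
    have hang : ∀ v, |v| ≤ π → cos (t - θ) = cos v → |v| < 7 * δ := by
      intro v hv huv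
      have h3 := sq_angle_le h0 hρr.le hv
      rw [← huv, ← norm_polar_sub_polar_sq] at h3
      have h4 := pow_le_pow_left₀ (norm_nonneg _) hmem'.le 2
      refine abs_lt_of_sq_lt_sq ?_ (by positivity)
      nlinarith [sq_pos_of_pos hδ0]
    have hmemball : ∀ x, |x - θ| < 7 * δ → W θ = χ x θ := by
      intro x hx
      simp only [hχ]
      rw [indicator_of_mem]
      rwa [Metric.mem_ball, dist_comm, Real.dist_eq]
    rcases exists_abs_translate_le_pi (u := t - θ) (by linarith [ht.1, hθ.2])
      (by linarith [ht.2, hθ.1]) with h | h | h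
    · rw [hmemball (t + 2 * π) (by
        rw [show t + 2 * π - θ = t - θ + 2 * π by ring]
        exact hang _ h (cos_add_two_pi _).symm)]
      exact le_self_add.trans le_self_add
    · rw [hmemball t (hang _ h rfl)]
      exact le_add_self.trans le_self_add
    · rw [hmemball (t - 2 * π) (by
        rw [show t - 2 * π - θ = t - θ - 2 * π by ring]
        exact hang _ h (cos_sub_two_pi _).symm)]
      exact le_add_self
  have hχM : ∀ x, ∫⁻ θ, χ x θ ≤ ENNReal.ofReal (14 * δ) * maximalFunction W x := by
    intro x
    simp only [hχ]
    rw [lintegral_indicator measurableSet_ball, show 14 * δ = 2 * (7 * δ) by ring]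
    exact lintegral_ball_le_maximalFunction W (Metric.mem_ball_self (by positivity))
  rw [← lintegral_indicator measurableSet_ball, lintegral_eq_lintegral_polar hFm]
  calc ∫⁻ ρ in Ioi (0 : ℝ), ∫⁻ θ in Ioo (-π) π, ENNReal.ofReal ρ * F (polar ρ θ)
      ≤ ∫⁻ ρ in Ioi (0 : ℝ), ∫⁻ θ in Ioo (-π) π, (Metric.ball r (δ / 2)).indicator
        (fun _ => χ (t + 2 * π) θ + χ t θ + χ (t - 2 * π) θ) ρ :=
        setLIntegral_mono' measurableSet_Ioi fun ρ hρ =>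
          setLIntegral_mono' measurableSet_Ioo fun θ hθ => hpt ρ hρ θ hθ
    _ ≤ ∫⁻ ρ, ∫⁻ θ, (Metric.ball r (δ / 2)).indicator
        (fun _ => χ (t + 2 * π) θ + χ t θ + χ (t - 2 * π) θ) ρ :=
        (setLIntegral_le_lintegral _ _).trans
          (lintegral_mono fun ρ => setLIntegral_le_lintegral _ _)
    _ = ∫⁻ ρ, (Metric.ball r (δ / 2)).indicator
        (fun _ => ∫⁻ θ, (χ (t + 2 * π) θ + χ t θ + χ (t - 2 * π) θ)) ρ := by
        refine lintegral_congr fun ρ => ?_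
        by_cases h : ρ ∈ Metric.ball r (δ / 2)
        · simp only [indicator_of_mem h]
        · simp only [indicator_of_notMem h, lintegral_zero]
    _ = ENNReal.ofReal δ * ((∫⁻ θ, χ (t + 2 * π) θ) + (∫⁻ θ, χ t θ) +
          ∫⁻ θ, χ (t - 2 * π) θ) := by
        rw [lintegral_indicator measurableSet_ball, setLIntegral_const, Real.volume_ball,
          lintegral_add_right _ (hχm _), lintegral_add_right _ (hχm _), mul_comm]
        congr 2
        ring
    _ ≤ ENNReal.ofReal δ * (ENNReal.ofReal (14 * δ) * maximalFunction W (t + 2 * π) +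
          ENNReal.ofReal (14 * δ) * maximalFunction W t +
          ENNReal.ofReal (14 * δ) * maximalFunction W (t - 2 * π)) := by
        gcongr <;> exact hχM _
    _ = ENNReal.ofReal (14 * δ ^ 2) * translatedMaximal W t := by
        rw [translatedMaximal, show 14 * δ ^ 2 = δ * (14 * δ) by ring, ENNReal.ofReal_mul hδ0.le]
        ring

/-- The weighted derivative is dominated by the squared maximal function of the square root of the
radial supremum. -/
theorem enorm_deriv_mul_le_translatedMaximal_sq {f : ℂ → ℂ}
    (hf : DifferentiableOn ℂ f (Metric.ball 0 1)) {r t : ℝ} (hr : r ∈ Ico (0 : ℝ) 1)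
    (ht : t ∈ Ico 0 (2 * π)) :
    ‖deriv f (polar r t) * ((1 - ‖polar r t‖ : ℝ) : ℂ)‖ₑ ≤
      4 * (3584 * translatedMaximal
        ((Ioo (-π) π).indicator fun θ => radialSup f θ ^ (1 / 2 : ℝ)) t) ^ 2 := by
  have h0 := hr.1
  have h1 := hr.2
  set δ := 1 - r with hδ
  have hδ0 : 0 < δ := by linarith
  set T := translatedMaximal ((Ioo (-π) π).indicator fun θ => radialSup f θ ^ (1 / 2 : ℝ)) t
    with hT
  by_cases hTtop : T = ∞
  · rw [hTtop]
    simp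
  have hN : (3584 * T) ^ 2 ≠ ∞ := ENNReal.pow_ne_top (ENNReal.mul_ne_top (by simp) hTtop)
  have hsub : Metric.closedBall (polar r t) (δ / 2) ⊆ Metric.ball 0 1 :=
    (Metric.closedBall_subset_ball' (by rw [dist_zero_right, norm_polar h0]; linarith))
  -- Discs of radius `δ/4` about points of this sphere stay in the disc of radius `δ/2` about `r
  -- e^{it}`. The constant is `3584 = 16 * 14 * 4²`, from the mean value inequality, the disc
  -- integral and the ratio of radii.
  have hsphere : ∀ w ∈ Metric.sphere (polar r t) (δ / 4), ‖f w‖ ≤ ((3584 * T) ^ 2).toReal := by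
    intro w hw
    have hw' : dist w (polar r t) = δ / 4 := hw
    have hcb : Metric.closedBall w (δ / 4) ⊆ Metric.ball 0 1 :=
      (Metric.closedBall_subset_closedBall' (by rw [hw']; linarith)).trans hsub
    have hb : Metric.ball w (δ / 4) ⊆ Metric.ball (polar r t) (δ / 2) :=
      Metric.ball_subset_ball' (by rw [hw']; linarith)
    have h2 := enorm_rpow_half_mul_le_lintegral (show 0 < δ / 4 by linarith)
      (hf.mono (Metric.ball_subset_closedBall.trans hcb)) (hf.continuousOn.mono hcb)
    have h3 : ‖f w‖ₑ ^ (1 / 2 : ℝ) * ENNReal.ofReal ((δ / 4) ^ 2) ≤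
        (3584 * T) * ENNReal.ofReal ((δ / 4) ^ 2) := by
      refine h2.trans ((mul_le_mul_right ((lintegral_mono_set hb).trans
        (lintegral_ball_rpow_half_le hf.continuousOn hr ht)) _).trans (le_of_eq ?_))
      rw [← hT, ← hδ, show 14 * δ ^ 2 = 224 * (δ / 4) ^ 2 by ring,
        ENNReal.ofReal_mul (by norm_num), show ENNReal.ofReal 224 = 224 by norm_num,
        show (3584 : ℝ≥0∞) = 16 * 224 by norm_num]
      ring
    have h4 : ‖f w‖ₑ ^ (1 / 2 : ℝ) ≤ 3584 * T := by
      refine (ENNReal.mul_le_mul_iff_left ?_ ENNReal.ofReal_ne_top).1 h3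
      rw [Ne, ENNReal.ofReal_eq_zero, not_le]
      positivity
    have h5 : ‖f w‖ₑ ≤ (3584 * T) ^ 2 := by
      have := pow_le_pow_left₀ (zero_le (a := ‖f w‖ₑ ^ (1 / 2 : ℝ))) h4 2
      rw [← ENNReal.rpow_natCast, ← ENNReal.rpow_mul] at this
      norm_num at this ⊢
      exact this
    rw [← toReal_enorm]
    exact ENNReal.toReal_mono hN h5
  have hder := Complex.norm_deriv_le_of_forall_mem_sphere_norm_le (show 0 < δ / 4 by linarith)
    (hf.diffContOnCl_ball ((Metric.closedBall_subset_closedBall (by linarith)).trans hsub)) hsphere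
  rw [norm_polar h0, ← hδ, ← ofReal_norm, norm_mul, Complex.norm_real, norm_of_nonneg hδ0.le]
  calc ENNReal.ofReal (‖deriv f (polar r t)‖ * δ)
      ≤ ENNReal.ofReal (4 * ((3584 * T) ^ 2).toReal) := by
        refine ENNReal.ofReal_le_ofReal ?_
        rw [le_div_iff₀ (by positivity)] at hder
        linarith
    _ = 4 * (3584 * T) ^ 2 := by
        rw [ENNReal.ofReal_mul (by norm_num), ENNReal.ofReal_toReal hN]
        norm_num

/-! ### The estimates case by case. -/

/-- Undoes the shift of radius introduced by Cauchy's formula: the substitution maps `[0, 1)` into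
itself with derivative `1/2`. -/
theorem lintegral_comp_one_add_div_two_le (G : ℝ → ℝ≥0∞) :
    ∫⁻ r in Ico (0 : ℝ) 1, G ((1 + r) / 2) ≤ 2 * ∫⁻ r in Ico (0 : ℝ) 1, G r := by
  have hd : ∀ r ∈ Ico (0 : ℝ) 1,
      HasDerivWithinAt (fun r : ℝ => (1 + r) / 2) (1 / 2) (Ico 0 1) r := fun r _ =>
    (((hasDerivAt_id r).const_add 1).div_const 2).hasDerivWithinAt
  have hinj : InjOn (fun r : ℝ => (1 + r) / 2) (Ico 0 1) := fun a _ b _ h => by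
    simp only at h; linarith
  have himg : (fun r : ℝ => (1 + r) / 2) '' Ico 0 1 ⊆ Ico 0 1 := by
    rintro _ ⟨r, hr, rfl⟩
    constructor <;> linarith [hr.1, hr.2]
  have h := lintegral_image_eq_lintegral_abs_deriv_mul measurableSet_Ico hd hinj G
  rw [lintegral_const_mul' _ _ (by simp)] at h
  have h2 : (2 : ℝ≥0∞) * ENNReal.ofReal |1 / 2| = 1 := by
    rw [show (2 : ℝ≥0∞) = ENNReal.ofReal 2 by norm_num, ← ENNReal.ofReal_mul (by norm_num)]
    norm_num
  calc ∫⁻ r in Ico (0 : ℝ) 1, G ((1 + r) / 2)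
      = 2 * ∫⁻ r in (fun r : ℝ => (1 + r) / 2) '' Ico 0 1, G r := by
        rw [h, ← mul_assoc, h2, one_mul]
    _ ≤ _ := mul_le_mul_right (lintegral_mono_set himg) _

theorem exists_lintegral_radial_rpow_deriv_le {p q : ℝ}
    (hpq : (1 < p ∧ 1 < q) ∨ (p = 1 ∧ 1 ≤ q)) :
    ∃ C : ℝ≥0, ∀ f : ℂ → ℂ, DifferentiableOn ℂ f (Metric.ball 0 1) →
      ∫⁻ t in Ico 0 (2 * π), (∫⁻ r in Ico (0 : ℝ) 1,
        ‖deriv f (polar r t) * ((1 - ‖polar r t‖ : ℝ) : ℂ)‖ₑ ^ p) ^ (q / p) ≤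
      C * ∫⁻ t in Ico 0 (2 * π), (∫⁻ r in Ico (0 : ℝ) 1, ‖f (polar r t)‖ₑ ^ p) ^ (q / p) := by
  have hp : 1 ≤ p := by rcases hpq with h | h <;> linarith [h.1]
  have hq : 1 ≤ q := by rcases hpq with h | h <;> linarith [h.2]
  have hp0 : 0 < p := by linarith
  have hq0 : 0 < q := by linarith
  have hqp : 0 < q / p := by positivity
  obtain ⟨C, hC⟩ : ∃ C : ℝ≥0, ∀ g : ℝ → ℝ → ℝ≥0∞, Measurable (Function.uncurry g) →
      ∫⁻ t in Ico 0 (2 * π), (∫⁻ r in Ico (0 : ℝ) 1,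
        (∫⁻ θ in Ico 0 (2 * π), discKernel r t θ * g r θ) ^ p) ^ (q / p) ≤
      C * ∫⁻ t in Ico 0 (2 * π), (∫⁻ r in Ico (0 : ℝ) 1, g r t ^ p) ^ (q / p) := by
    -- When `p = 1`, the assumption `1 ≤ q` excludes `q < p`, so the second branch always has `q >
    -- 1`.
    rcases le_or_gt p q with h | h
    · exact isMaximalKernel_discKernel.exists_mixedNorm_le_of_le hp h
    · refine isMaximalKernel_discKernel.exists_mixedNorm_le_of_lt ?_ h
      rcases hpq with h' | h' <;> linarith [h'.1, h'.2]
  refine ⟨2 ^ q * C * 2 ^ (q / p), fun f hf => ?_⟩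
  set F : ℂ → ℝ≥0∞ := (Metric.ball 0 1).indicator fun z => ‖f z‖ₑ with hF
  have hFm : Measurable F :=
    (continuous_enorm.comp_continuousOn hf.continuousOn).measurable_indicator measurableSet_ball
  have hFf : ∀ r ∈ Ico (0 : ℝ) 1, ∀ t, F (polar r t) = ‖f (polar r t)‖ₑ := fun r hr t => by
    rw [hF, indicator_of_mem]
    rw [mem_ball_zero_iff, norm_polar hr.1]
    exact hr.2
  have hmid : ∀ r ∈ Ico (0 : ℝ) 1, (1 + r) / 2 ∈ Ico (0 : ℝ) 1 := fun r hr => by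
    constructor <;> linarith [hr.1, hr.2]
  calc ∫⁻ t in Ico 0 (2 * π), (∫⁻ r in Ico (0 : ℝ) 1,
        ‖deriv f (polar r t) * ((1 - ‖polar r t‖ : ℝ) : ℂ)‖ₑ ^ p) ^ (q / p)
      ≤ ∫⁻ t in Ico 0 (2 * π), (∫⁻ r in Ico (0 : ℝ) 1, 2 ^ p *
          (∫⁻ θ in Ico 0 (2 * π), discKernel r t θ * F (polar ((1 + r) / 2) θ)) ^ p) ^ (q / p) := by
        refine setLIntegral_mono' measurableSet_Ico fun t ht => ENNReal.rpow_le_rpow ?_ hqp.le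
        refine setLIntegral_mono' measurableSet_Ico fun r hr => ?_
        rw [← ENNReal.mul_rpow_of_nonneg _ _ hp0.le]
        refine ENNReal.rpow_le_rpow ((enorm_deriv_mul_le_lintegral hf hr ht).trans (le_of_eq ?_))
          hp0.le
        simp only [hFf _ (hmid r hr)]
    _ = 2 ^ q * ∫⁻ t in Ico 0 (2 * π), (∫⁻ r in Ico (0 : ℝ) 1,
          (∫⁻ θ in Ico 0 (2 * π), discKernel r t θ * F (polar ((1 + r) / 2) θ)) ^ p) ^ (q / p) := by
        rw [← lintegral_const_mul' _ _ (by simp)]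
        refine lintegral_congr fun t => ?_
        rw [lintegral_const_mul' _ _ (by simp), ENNReal.mul_rpow_of_nonneg _ _ hqp.le,
          ← ENNReal.rpow_mul, mul_div_cancel₀ _ hp0.ne']
    _ ≤ 2 ^ q * (C * ∫⁻ t in Ico 0 (2 * π), (∫⁻ r in Ico (0 : ℝ) 1,
          F (polar ((1 + r) / 2) t) ^ p) ^ (q / p)) := by
        refine mul_le_mul_right (hC (fun r θ => F (polar ((1 + r) / 2) θ)) ?_) _
        exact hFm.comp (continuous_polar.measurable.comp
          (f := fun z : ℝ × ℝ => ((1 + z.1) / 2, z.2)) (by fun_prop))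
    _ ≤ 2 ^ q * (C * ∫⁻ t in Ico 0 (2 * π), (2 * ∫⁻ r in Ico (0 : ℝ) 1,
          ‖f (polar r t)‖ₑ ^ p) ^ (q / p)) := by
        gcongr with t
        refine (lintegral_comp_one_add_div_two_le fun r => F (polar r t) ^ p).trans (le_of_eq ?_)
        congr 1
        refine setLIntegral_congr_fun measurableSet_Ico fun r hr => ?_
        simp only [hFf r hr]
    _ = _ := by
        simp_rw [ENNReal.mul_rpow_of_nonneg _ _ hqp.le]
        rw [lintegral_const_mul' _ _ (by simp)]
        push_cast [ENNReal.coe_rpow_of_nonneg (2 : ℝ≥0) hqp.le,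
          ENNReal.coe_rpow_of_nonneg (2 : ℝ≥0) hq0.le]
        ring

/-- The square root doubles the exponent: the maximal theorem is used in `L^{2q}`, which is
admissible even for `q = 1`. -/
theorem exists_lintegral_radialSup_deriv_le {q : ℝ} (hq : 1 ≤ q) :
    ∃ C : ℝ≥0, ∀ f : ℂ → ℂ, DifferentiableOn ℂ f (Metric.ball 0 1) →
      ∫⁻ t in Ico 0 (2 * π), (⨆ r ∈ Ico (0 : ℝ) 1,
        ‖deriv f (polar r t) * ((1 - ‖polar r t‖ : ℝ) : ℂ)‖ₑ) ^ q ≤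
      C * ∫⁻ t in Ico 0 (2 * π), (⨆ r ∈ Ico (0 : ℝ) 1, ‖f (polar r t)‖ₑ) ^ q := by
  have hq0 : 0 < q := by linarith
  obtain ⟨C, hC⟩ := exists_lintegral_translatedMaximal_rpow_le (s := 2 * q) (by linarith)
  refine ⟨(4 * 3584 ^ 2) ^ q * C, fun f hf => ?_⟩
  have hm := measurable_radialSup hf.continuousOn
  set W := (Ioo (-π) π).indicator fun θ => radialSup f θ ^ (1 / 2 : ℝ) with hW
  have hWm : Measurable W := (hm.pow_const _).indicator measurableSet_Ioo
  have hfin : ((4 * 3584 ^ 2 : ℝ≥0∞)) ^ q ≠ ∞ :=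
    ENNReal.rpow_ne_top_of_nonneg hq0.le (by norm_num)
  calc ∫⁻ t in Ico 0 (2 * π), (⨆ r ∈ Ico (0 : ℝ) 1,
        ‖deriv f (polar r t) * ((1 - ‖polar r t‖ : ℝ) : ℂ)‖ₑ) ^ q
      ≤ ∫⁻ t in Ico 0 (2 * π), (4 * 3584 ^ 2) ^ q * translatedMaximal W t ^ (2 * q) := by
        refine setLIntegral_mono' measurableSet_Ico fun t ht => ?_
        rw [ENNReal.rpow_mul, ← ENNReal.mul_rpow_of_nonneg _ _ hq0.le]
        refine ENNReal.rpow_le_rpow (iSup₂_le fun r hr => ?_) hq0.le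
        refine (enorm_deriv_mul_le_translatedMaximal_sq hf hr ht).trans (le_of_eq ?_)
        rw [mul_pow, ENNReal.rpow_ofNat, mul_assoc]
    _ ≤ (4 * 3584 ^ 2) ^ q * ∫⁻ t, translatedMaximal W t ^ (2 * q) := by
        rw [lintegral_const_mul' _ _ hfin]
        exact mul_le_mul_right (setLIntegral_le_lintegral _ _) _
    _ ≤ (4 * 3584 ^ 2) ^ q * (C * ∫⁻ t, W t ^ (2 * q)) := mul_le_mul_right (hC W hWm) _
    _ = (4 * 3584 ^ 2) ^ q * (C * ∫⁻ t in Ico 0 (2 * π), radialSup f t ^ q) := by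
        congr 2
        rw [← lintegral_Ioo_eq_lintegral_Ico_of_periodic (F := fun t => radialSup f t ^ q)
          fun t => by simp only [radialSup_periodic f t], ← lintegral_indicator measurableSet_Ioo]
        refine lintegral_congr fun t => ?_
        by_cases ht : t ∈ Ioo (-π) π
        · rw [hW, indicator_of_mem ht, indicator_of_mem ht, ← ENNReal.rpow_mul]
          congr 1
          ring
        · rw [hW, indicator_of_notMem ht, indicator_of_notMem ht,
            ENNReal.zero_rpow_of_pos (by positivity)]
    _ = _ := by
        push_cast [ENNReal.coe_rpow_of_nonneg (4 * 3584 ^ 2 : ℝ≥0) hq0.le]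
        simp only [radialSup]
        ring

/-- Cauchy's estimate on the circle of radius `(1 - ‖z‖) / 2` about `z`. -/
theorem iSup_ball_enorm_deriv_mul_le {f : ℂ → ℂ} (hf : DifferentiableOn ℂ f (Metric.ball 0 1)) :
    ⨆ z ∈ Metric.ball (0 : ℂ) 1, ‖deriv f z * ((1 - ‖z‖ : ℝ) : ℂ)‖ₑ ≤
      2 * ⨆ z ∈ Metric.ball (0 : ℂ) 1, ‖f z‖ₑ := by
  set S := ⨆ z ∈ Metric.ball (0 : ℂ) 1, ‖f z‖ₑ with hS
  by_cases hStop : S = ∞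
  · simp [hStop]
  refine iSup₂_le fun z hz => ?_
  have hz1 : 0 < 1 - ‖z‖ := sub_pos.2 (mem_ball_zero_iff.1 hz)
  have hsub : Metric.closedBall z ((1 - ‖z‖) / 2) ⊆ Metric.ball 0 1 :=
    Metric.closedBall_subset_ball' (by rw [dist_zero_right]; linarith)
  have hder := Complex.norm_deriv_le_of_forall_mem_sphere_norm_le (half_pos hz1)
    (hf.diffContOnCl_ball hsub) (C := S.toReal) fun w hw => by
      rw [← toReal_enorm]
      exact ENNReal.toReal_mono hStop (le_iSup₂ (f := fun z (_ : z ∈ Metric.ball (0 : ℂ) 1) =>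
        ‖f z‖ₑ) w (hsub (Metric.sphere_subset_closedBall hw)))
  rw [← ofReal_norm, norm_mul, Complex.norm_real, norm_of_nonneg hz1.le]
  calc ENNReal.ofReal (‖deriv f z‖ * (1 - ‖z‖)) ≤ ENNReal.ofReal (2 * S.toReal) := by
        refine ENNReal.ofReal_le_ofReal ?_
        rw [le_div_iff₀ (half_pos hz1)] at hder
        linarith
    _ = 2 * S := by
        rw [ENNReal.ofReal_mul (by norm_num), ENNReal.ofReal_toReal hStop]
        norm_num

/-- The added 1 makes the final constant strictly positive even if `C = 0`. -/
theorem rpow_one_div_le_of_le {A B c : ℝ≥0∞} {C : ℝ≥0} {q : ℝ} (hq : 0 < q) (h : A ≤ C * B) :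
    (c * A) ^ (1 / q) ≤ (C ^ (1 / q) + 1 : ℝ≥0) * (c * B) ^ (1 / q) := by
  have hq' : 0 ≤ 1 / q := by positivity
  calc (c * A) ^ (1 / q) ≤ (C * (c * B)) ^ (1 / q) := by
        refine ENNReal.rpow_le_rpow ((mul_le_mul_right h c).trans (le_of_eq ?_)) hq'
        ring
    _ = (C ^ (1 / q) : ℝ≥0) * (c * B) ^ (1 / q) := by
        rw [ENNReal.mul_rpow_of_nonneg _ _ hq', ENNReal.coe_rpow_of_nonneg _ hq']
    _ ≤ _ := by
        gcongr
        exact le_self_add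

end AvgRadial

theorem mainTheorem10 (p q : ℝ≥0∞)
    (hpq : (1 < p ∧ p < ∞ ∧ 1 < q ∧ q < ∞) ∨ (p = 1 ∧ 1 ≤ q ∧ q < ∞) ∨ (p = ∞ ∧ 1 ≤ q)) :
    ∃ C : ℝ≥0, 0 < C ∧ ∀ f ∈ AvgRadial.RM p q,
      AvgRadial.rho p q (fun z : ℂ => deriv f z * ((1 - ‖z‖ : ℝ) : ℂ)) ≤
        (C : ℝ≥0∞) * AvgRadial.rho p q f := by
  have hq1 : q ≠ ∞ → 1 ≤ q.toReal := fun hq => by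
    have : 1 ≤ q := by
      rcases hpq with h | h | h
      exacts [h.2.2.1.le, h.2.1, h.2]
    simpa using ENNReal.toReal_mono hq this
  by_cases hp : p = ∞
  · by_cases hq : q = ∞
    · refine ⟨2, by norm_num, fun f hf => ?_⟩
      simp only [AvgRadial.rho, if_pos hp, if_pos hq]
      exact AvgRadial.iSup_ball_enorm_deriv_mul_le hf.1
    · obtain ⟨C, hC⟩ := AvgRadial.exists_lintegral_radialSup_deriv_le (hq1 hq)
      refine ⟨C ^ (1 / q.toReal) + 1, by positivity, fun f hf => ?_⟩
      simp only [AvgRadial.rho, if_pos hp, if_neg hq]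
      exact AvgRadial.rpow_one_div_le_of_le (by linarith [hq1 hq]) (hC f hf.1)
  · have hq : q ≠ ∞ := by
      rcases hpq with h | h | h
      exacts [h.2.2.2.ne, h.2.2.ne, absurd h.1 hp]
    have hpq' : (1 < p.toReal ∧ 1 < q.toReal) ∨ (p.toReal = 1 ∧ 1 ≤ q.toReal) := by
      rcases hpq with h | h | h
      · left
        constructor
        · simpa using (ENNReal.toReal_lt_toReal (by simp) hp).2 h.1
        · simpa using (ENNReal.toReal_lt_toReal (by simp) hq).2 h.2.2.1
      · right
        exact ⟨by simp [h.1], hq1 hq⟩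
      · exact absurd h.1 hp
    obtain ⟨C, hC⟩ := AvgRadial.exists_lintegral_radial_rpow_deriv_le hpq'
    refine ⟨C ^ (1 / q.toReal) + 1, by positivity, fun f hf => ?_⟩
    simp only [AvgRadial.rho, if_neg hp, if_neg hq]
    exact AvgRadial.rpow_one_div_le_of_le (by linarith [hq1 hq]) (hC f hf.1)
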